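/- For $0\le k\le n$ let $Gr(k,n)$ denote the Grassmannian of $(k+1)$-dimensional subspaces of $\mathbb{C}^{n+1}$, embedded in $\mathbb{P}(\wedge^{k+1}\mathbb{C}^{n+1})$ by the Plücker map $\langle v_0,\dots,v_k\rangle\mapsto[v_0\wedge\cdots\wedge v_k]$. For a projective variety $X\subseteq\mathbb{P}^N$ let $\sigma_s(X)$ be its $s$-secant variety, that is, the Zariski closure in $\mathbb{P}^N$ of the union of the linear spans $\langle Q_1,\dots,Q_s\rangle$ over all $s$-tuples of points $Q_1,\dots,Q_s\in X$. For a tensor $\omega\in\wedge^3\mathbb{C}^7$ and a set $Y\subseteq\mathbb{P}(\wedge^3\mathbb{C}^7)$ write $\omega\in Y$ if $\omega$ lies in the affine cone over $Y$, that is, if $\omega=0$ or $[\omega]\in Y$. Let $$\phi_\omega\colon\wedge^2\mathbb{C}^7\to\wedge^5\mathbb{C}^7,\qquad \phi_\omega(\eta)=\eta\wedge\omega,$$ be the contraction operator of $\omega$. Theorem. For every $\omega\in\wedge^3\mathbb{C}^7$: (i) $\omega\in Gr(2,6)$ if and only if $\operatorname{rank}\phi_\omega\le 6$. (ii) $\omega\in\sigma_2(Gr(2,6))$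 if and only if $\operatorname{rank}\phi_\omega\le 12$. Hence the $13\times13$ minors of $\phi_\omega$ give set-theoretic equations of $\sigma_2(Gr(2,6))$: with respect to any bases of the $21$-dimensional spaces $\wedge^2\mathbb{C}^7$ and $\wedge^5\mathbb{C}^7$, $\omega\in\sigma_2(Gr(2,6))$ if and only if all $13\times 13$ minors of the matrix of $\phi_\omega$ vanish. (iii) $\omega\in\sigma_3(Gr(2,6))$ if and only if $\operatorname{rank}\phi_\omega\le 18$. -/

import Mathlib

open scoped LinearAlgebra.Projectivization

noncomputable section

namespace SecantGrassmannian

/-- The value at `w` of a polynomial function on the complex vector space `W`. A polynomial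
function is written as a polynomial in the linear forms on `W`: the variable with index
`l : Module.Dual ℂ W` takes the value `l w`. -/
def polyEval {W : Type*} [AddCommGroup W] [Module ℂ W]
    (f : MvPolynomial (Module.Dual ℂ W) ℂ) (w : W) : ℂ :=
  MvPolynomial.eval (fun l : Module.Dual ℂ W => l w) f

/-- The Zariski closure of a set `S` of points of the projective space `ℙ ℂ W`: the points at
which every homogeneous polynomial vanishing on `S` vanishes. By homogeneity it does not matter
which representatives are used. -/
def zariskiClosure {W : Type*} [AddCommGroup W] [Module ℂ W] (S : Set (ℙ ℂ W)) : Set (ℙ ℂ W) :=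
  {P | ∀ (d : ℕ) (f : MvPolynomial (Module.Dual ℂ W) ℂ), f.IsHomogeneous d →
    (∀ Q ∈ S, polyEval f Q.rep = 0) → polyEval f P.rep = 0}

/-- The `s`-secant variety of `X`: the Zariski closure of the union of the projective linear spans
of all `s`-tuples of points of `X`. -/
def secantVariety {W : Type*} [AddCommGroup W] [Module ℂ W] (s : ℕ) (X : Set (ℙ ℂ W)) :
    Set (ℙ ℂ W) :=
  zariskiClosure (⋃ Q : Fin s → X,
    (Projectivization.Subspace.span (Set.range fun i => (Q i : ℙ ℂ W)) : Set (ℙ ℂ W)))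

/-- The affine cone over a set of points of projective space: the zero vector and all the
representatives of the points. -/
def affineCone {W : Type*} [AddCommGroup W] [Module ℂ W] (X : Set (ℙ ℂ W)) : Set W :=
  {w | ∀ hw : w ≠ 0, Projectivization.mk ℂ w hw ∈ X}

/-- The Grassmannian `Gr(k, n)` of projective `k`-planes in `ℙⁿ`, in its Plücker embedding: the
subspace of `ℂⁿ⁺¹` with basis `v₀, …, vₖ` is the point of `ℙ(⋀ᵏ⁺¹ ℂⁿ⁺¹)` given by the line
spanned by `v₀ ∧ ⋯ ∧ vₖ`. -/
def Gr (k n : ℕ) : Set (ℙ ℂ (⋀[ℂ]^(k + 1) (Fin (n + 1) → ℂ))) :=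
  {P | ∃ v : Fin (k + 1) → (Fin (n + 1) → ℂ), LinearIndependent ℂ v ∧
    P.submodule = Submodule.span ℂ {exteriorPower.ιMulti ℂ (k + 1) v}}

/-- The contraction operator `φ_ω : ⋀² ℂ⁷ → ⋀⁵ ℂ⁷`, `η ↦ η ∧ ω`, for `ω ∈ ⋀³ ℂ⁷`. It is linear
in `ω` too. The wedge product is the product of the exterior algebra. -/
def contraction : (⋀[ℂ]^3 (Fin 7 → ℂ)) →ₗ[ℂ]
    (⋀[ℂ]^2 (Fin 7 → ℂ)) →ₗ[ℂ] (⋀[ℂ]^5 (Fin 7 → ℂ)) :=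
  LinearMap.mk₂ ℂ
    (fun ω η => ⟨(η : ExteriorAlgebra ℂ (Fin 7 → ℂ)) * (ω : ExteriorAlgebra ℂ (Fin 7 → ℂ)),
      SetLike.mul_mem_graded (A := fun i : ℕ => ⋀[ℂ]^i (Fin 7 → ℂ)) η.2 ω.2⟩)
    (fun _ _ _ => Subtype.ext (mul_add _ _ _))
    (fun c _ _ => Subtype.ext (mul_smul_comm c _ _))
    (fun _ _ _ => Subtype.ext (add_mul _ _ _))
    (fun c _ _ => Subtype.ext (smul_mul_assoc c _ _))

/-- The rank of `φ_ω`. -/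
def contractionRank (ω : ⋀[ℂ]^3 (Fin 7 → ℂ)) : ℕ :=
  Module.finrank ℂ (LinearMap.range (contraction ω))

end SecantGrassmannian

end

noncomputable section

namespace SecantGrassmannian

open Topology Filter

/-! Write V for ℂ⁷. A trivector ω is the same as the alternating four-form `quad ω` on V, and η lies
in the kernel of φ_ω exactly when `quad ω x y` vanishes on η for all x, y. Every rank condition
becomes a statement about this kernel.

Necessity: e₀ ∧ e₁ ∧ e₂ has contraction of rank at most 6, rank is subadditive, and minors are
homogeneous polynomials, so rank ≤ 6s passes to the closure
(`contractionRank_le_of_mem_affineCone`).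

Sufficiency rests on the normal forms of a nonzero kernel element η (`exists_basis_of_mem_ker`).
Rank 2 puts ω in U ∧ ⋀²V with dim U = 2, rank 4 puts it in ⋀²W ∧ V with dim W = 4, rank 6 puts it in
⋀³H with H a hyperplane. A Terracini argument (`polyEval_eq_zero_of_tangent`) shows that sums of
three decomposables, and in ⋀³H already of two, are dense in these spaces. As rank ≤ 18 gives a
nonzero kernel, (iii) follows.

For (ii) the kernel has dimension at least 9, hence contains an indecomposable η
(`exists_indecomposable_bivector`). Rank 6 is settled as before. In rank 4, ω gives three two-forms
on W. If they are dependent, ω again lies in some ⋀³H. Otherwise a combination of them has nonzero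
Pfaffian, and `finrank_ker_le_seven` contradicts the dimension of the kernel.

For (i), if `quad ω` is nonzero on u₀, …, u₃, the images of the six products uᵢ ∧ uⱼ already span
the range. This forces enough products into the kernel to make ω a multiple of one basis trivector.
-/

/-! ### Density of sums of decomposables from tangent spaces. -/

/-- The restriction of a polynomial function to the line through `p` with direction `q` is a
polynomial in one variable. -/
theorem exists_polynomial_eval_line {W : Type*} [AddCommGroup W] [Module ℂ W]
    (f : MvPolynomial (Module.Dual ℂ W) ℂ) (p q : W) :
    ∃ h : Polynomial ℂ, ∀ t : ℂ, h.eval t = polyEval f (p + t • q) := by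
  refine ⟨MvPolynomial.eval₂ Polynomial.C
    (fun l => Polynomial.C (l p) + Polynomial.X * Polynomial.C (l q)) f, fun t => ?_⟩
  unfold polyEval
  rw [← Polynomial.coe_evalRingHom, MvPolynomial.hom_eval₂]
  have : (Polynomial.evalRingHom t).comp Polynomial.C = RingHom.id ℂ := by ext; simp
  rw [this]
  change _ = MvPolynomial.eval₂ (RingHom.id ℂ) _ f
  congr 1
  ext l
  simp only [Polynomial.coe_evalRingHom, Polynomial.eval_mul, Polynomial.eval_C, Polynomial.eval_X,
    map_add, map_smul, smul_eq_mul]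

/-- A polynomial function which vanishes near a point vanishes everywhere. -/
theorem polyEval_eq_zero_of_eventually {W Y : Type*} [AddCommGroup W] [Module ℂ W]
    [NormedAddCommGroup Y] [NormedSpace ℂ Y] (f : MvPolynomial (Module.Dual ℂ W) ℂ)
    (G : Y →ₗ[ℂ] W) (y₀ : Y) (h : ∀ᶠ y in 𝓝 y₀, polyEval f (G y) = 0) (y : Y) :
    polyEval f (G y) = 0 := by
  obtain ⟨p, hp⟩ := exists_polynomial_eval_line f (G y₀) (G (y - y₀))
  have hc : Tendsto (fun t : ℂ => y₀ + t • (y - y₀)) (𝓝 0) (𝓝 y₀) := by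
    have : Continuous fun t : ℂ => y₀ + t • (y - y₀) := by fun_prop
    simpa using this.tendsto 0
  have hz : p = 0 := by
    refine Polynomial.eq_zero_of_infinite_isRoot p (infinite_of_mem_nhds (0 : ℂ) ?_)
    filter_upwards [hc.eventually h] with t ht
    change p.eval t = 0
    rw [hp]
    simpa using ht
  have := hp 1
  simpa [hz] using this.symm

/-- If the sum of `s` values of a multilinear map `g` with values in `L` has, at some point, a
differential onto `L`, then a polynomial function vanishing on all such sums vanishes on `L`. -/
theorem polyEval_eq_zero_of_tangent {V W : Type*} [NormedAddCommGroup V] [NormedSpace ℂ V]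
    [FiniteDimensional ℂ V] [AddCommGroup W] [Module ℂ W] [FiniteDimensional ℂ W] {m s : ℕ}
    (g : MultilinearMap ℂ (fun _ : Fin m => V) W) (L : Submodule ℂ W) (hL : ∀ v, g v ∈ L)
    (v₀ : Fin s → Fin m → V)
    (hT : L ≤ Submodule.span ℂ {y | ∃ i j δ, y = g (Function.update (v₀ i) j δ)})
    (f : MvPolynomial (Module.Dual ℂ W) ℂ)
    (hf : ∀ v : Fin s → Fin m → V, polyEval f (∑ i, g (v i)) = 0) {y : W} (hy : y ∈ L) :
    polyEval f y = 0 := by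
  classical
  obtain ⟨π, hπ⟩ := LinearMap.exists_leftInverse_of_injective L.subtype (Submodule.ker_subtype L)
  let ψ := (Module.finBasis ℂ L).equivFun
  -- `W` carries no norm, so the calculus takes place in coordinates of `L`: `ρ` projects onto them
  -- and `G` maps back.
  let ρ : W →ₗ[ℂ] (Fin (Module.finrank ℂ L) → ℂ) := ψ.toLinearMap ∘ₗ π
  let G : (Fin (Module.finrank ℂ L) → ℂ) →ₗ[ℂ] W := L.subtype ∘ₗ ψ.symm.toLinearMap
  have hπ' : ∀ x : L, π x = x := fun x => LinearMap.congr_fun hπ x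
  have hG : ∀ x ∈ L, G (ρ x) = x := by
    intro x hx
    simp only [G, ρ, LinearMap.comp_apply, LinearEquiv.coe_coe, LinearEquiv.symm_apply_apply]
    rw [hπ' ⟨x, hx⟩]; rfl
  have hρ : ∀ z, ρ (G z) = z := by
    intro z
    simp only [G, ρ, LinearMap.comp_apply, LinearEquiv.coe_coe]
    erw [hπ']
    simp
  let F : (Fin s → Fin m → V) → (Fin (Module.finrank ℂ L) → ℂ) := fun v => ρ (∑ i, g (v i))
  let b := Module.finBasis ℂ V
  -- Expanded in a basis of `V`, `F` is a polynomial in continuous coordinate functionals, hence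
  -- differentiable.
  have hFe : F = fun v => ∑ i, ∑ r : Fin m → Fin (Module.finrank ℂ V),
      (∏ j, LinearMap.toContinuousLinearMap (b.coord (r j)) (v i j)) •
        ρ (g fun j => b (r j)) := by
    funext v
    simp only [F, map_sum]
    refine Finset.sum_congr rfl fun i _ => ?_
    conv_lhs => rw [show v i = fun j => ∑ k, b.repr (v i j) k • b k from
      funext fun j => (b.sum_repr _).symm]
    rw [MultilinearMap.map_sum]
    simp only [map_sum, MultilinearMap.map_smul_univ, map_smul]
    rfl
  have hFc : ContDiff ℂ 1 F := by
    rw [hFe]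
    fun_prop
  have hFs : HasStrictFDerivAt F (fderiv ℂ F v₀) v₀ :=
    hFc.contDiffAt.hasStrictFDerivAt (by simp)
  have hgen : ∀ i j δ, ρ (g (Function.update (v₀ i) j δ)) ∈
      LinearMap.range (fderiv ℂ F v₀).toLinearMap := by
    intro i j δ
    let d : Fin s → Fin m → V := Pi.single i (Pi.single j δ)
    refine ⟨d, ?_⟩
    have h1 : HasDerivAt (fun t : ℂ => F (v₀ + t • d)) (fderiv ℂ F v₀ d) 0 := by
      have hl : HasDerivAt (fun t : ℂ => v₀ + t • d) d 0 := by
        simpa using ((hasDerivAt_id (0 : ℂ)).smul_const d).const_add v₀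
      have := hFs.hasFDerivAt
      have h0 : v₀ = v₀ + (0 : ℂ) • d := by simp
      have h3 : HasFDerivAt F (fderiv ℂ F v₀) (v₀ + (0 : ℂ) • d) := by rwa [← h0]
      exact h3.comp_hasDerivAt (0 : ℂ) hl
    -- Only one slot of one summand moves, so by multilinearity `F` is affine in `t`.
    have h2 : (fun t : ℂ => F (v₀ + t • d)) =
        fun t => F v₀ + t • ρ (g (Function.update (v₀ i) j δ)) := by
      funext t
      simp only [F]
      rw [← map_smul, ← map_add]
      congr 1
      have : ∀ k, g ((v₀ + t • d) k) =
          g (v₀ k) + if k = i then t • g (Function.update (v₀ i) j δ) else 0 := by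
        intro k
        split_ifs with hk
        · subst hk
          have : (v₀ + t • d) k = Function.update (v₀ k) j (v₀ k j + t • δ) := by
            funext l
            by_cases hl : l = j
            · subst hl; simp [d]
            · simp [d, hl]
          rw [this, g.map_update_add, g.map_update_smul, Function.update_eq_self]
        · simp [d, hk]
      simp_rw [this, Finset.sum_add_distrib]
      simp
    have h3 : HasDerivAt (fun t : ℂ => F v₀ + t • ρ (g (Function.update (v₀ i) j δ)))
        (ρ (g (Function.update (v₀ i) j δ))) 0 := by
      simpa using ((hasDerivAt_id (0 : ℂ)).smul_const
        (ρ (g (Function.update (v₀ i) j δ)))).const_add (F v₀)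
    rw [h2] at h1
    exact h1.unique h3
  have hsurj : LinearMap.range (fderiv ℂ F v₀).toLinearMap = ⊤ := by
    rw [eq_top_iff]
    intro z _
    rw [← hρ z]
    have hz : G z ∈ L := (ψ.symm z).2
    have hz' := Submodule.mem_map_of_mem (f := ρ) (hT hz)
    rw [Submodule.map_span] at hz'
    refine (Submodule.span_le.2 ?_) hz'
    rintro _ ⟨_, ⟨i, j, δ, rfl⟩, rfl⟩
    exact hgen i j δ
  have hev : ∀ᶠ z in 𝓝 (F v₀), polyEval f (G z) = 0 := by
    -- A strictly differentiable map with surjective differential is open at the point, so the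
    -- values of `F` fill a neighbourhood.
    rw [← hFs.map_nhds_eq_of_surj hsurj, Filter.eventually_map]
    refine Eventually.of_forall fun v => ?_
    rw [hG _ (L.sum_mem fun i _ => hL (v i))]
    exact hf v
  have := polyEval_eq_zero_of_eventually f G _ hev (ρ y)
  rwa [hG y hy] at this

/-- A polynomial function vanishing on all sums of `s` decomposable trivectors vanishes on the span
of the basis trivectors with indices in given sets, if these trivectors are tangent at some point to
the sums of `s` decomposable trivectors with factors in the corresponding coordinate subspaces. -/
theorem polyEval_eq_zero_of_mem_span_basis {s : ℕ} (e : Module.Basis (Fin 7) ℂ (Fin 7 → ℂ))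
    (I : Fin 3 → Finset (Fin 7)) (v₀ : Fin s → Fin 3 → (Fin 7 → ℂ))
    (hv₀ : ∀ i j, v₀ i j ∈ Submodule.span ℂ (e '' I j))
    (hT : ∀ r : Fin 3 → Fin 7, (∀ j, r j ∈ I j) → exteriorPower.ιMulti ℂ 3 (e ∘ r) ∈
      Submodule.span ℂ {y | ∃ i j, ∃ k ∈ I j,
        y = exteriorPower.ιMulti ℂ 3 (Function.update (v₀ i) j (e k))})
    (f : MvPolynomial (Module.Dual ℂ (⋀[ℂ]^3 (Fin 7 → ℂ))) ℂ)
    (hf : ∀ v : Fin s → Fin 3 → (Fin 7 → ℂ),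
      polyEval f (∑ i, exteriorPower.ιMulti ℂ 3 (v i)) = 0)
    {ω : ⋀[ℂ]^3 (Fin 7 → ℂ)}
    (hω : ω ∈ Submodule.span ℂ {y | ∃ r : Fin 3 → Fin 7, (∀ j, r j ∈ I j) ∧
      y = exteriorPower.ιMulti ℂ 3 (e ∘ r)}) :
    polyEval f ω = 0 := by
  classical
  -- Projecting the j-th factor onto its coordinate subspace turns the wedge map into a multilinear
  -- map with all values in the given span.
  let P : Fin 3 → (Fin 7 → ℂ) →ₗ[ℂ] (Fin 7 → ℂ) := fun j =>
    e.constr ℂ fun i => if i ∈ I j then e i else 0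
  have hP : ∀ j k, P j (e k) = if k ∈ I j then e k else 0 := fun j k => by simp [P]
  have hPv : ∀ i j, P j (v₀ i j) = v₀ i j := by
    intro i j
    have h : Submodule.span ℂ (e '' I j) ≤ LinearMap.eqLocus (P j) LinearMap.id := by
      rw [Submodule.span_le]
      rintro _ ⟨k, hk, rfl⟩
      simpa [hP] using fun h => (h hk).elim
    exact h (hv₀ i j)
  let g := (exteriorPower.ιMulti ℂ 3 (M := Fin 7 → ℂ)).toMultilinearMap.compLinearMap P
  have hg : ∀ v, g v = exteriorPower.ιMulti ℂ 3 fun j => P j (v j) := fun v => rfl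
  refine polyEval_eq_zero_of_tangent g _ ?_ v₀ ?_ f (fun v => hf _) hω
  · intro v
    rw [show v = fun j => ∑ k, e.repr (v j) k • e k from funext fun j => (e.sum_repr _).symm,
      MultilinearMap.map_sum]
    refine Submodule.sum_mem _ fun r _ => ?_
    rw [MultilinearMap.map_smul_univ]
    refine Submodule.smul_mem _ _ ?_
    by_cases hr : ∀ j, r j ∈ I j
    · refine Submodule.subset_span ⟨r, hr, ?_⟩
      rw [hg]
      congr 1
      funext j
      simp [hP, hr j]
    · push Not at hr
      obtain ⟨j, hj⟩ := hr
      rw [hg, AlternatingMap.map_coord_zero _ j (by simp [hP, hj])]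
      exact Submodule.zero_mem _
  · rw [Submodule.span_le]
    rintro _ ⟨r, hr, rfl⟩
    refine Submodule.span_mono ?_ (hT r hr)
    rintro _ ⟨i, j, k, hk, rfl⟩
    refine ⟨i, j, e k, ?_⟩
    rw [hg]
    congr 1
    funext l
    by_cases h : l = j
    · subst h; simp [hP, hk]
    · simp [h, hPv]

/-! ### Basis trivectors and the three dense families. -/

/-- The basis trivector `eᵢ ∧ eⱼ ∧ eₖ`. -/
def wedge₃ (e : Module.Basis (Fin 7) ℂ (Fin 7 → ℂ)) (i j k : Fin 7) : ⋀[ℂ]^3 (Fin 7 → ℂ) :=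
  exteriorPower.ιMulti ℂ 3 ![e i, e j, e k]

theorem wedge₃_swap_left (e : Module.Basis (Fin 7) ℂ (Fin 7 → ℂ)) (i j k : Fin 7) :
    wedge₃ e j i k = -wedge₃ e i j k := by
  rw [wedge₃, wedge₃, ← AlternatingMap.map_swap _ _ (i := 0) (j := 1) (by decide)]
  congr 1
  funext l
  fin_cases l <;> simp [Equiv.swap_apply_def]

theorem wedge₃_swap_right (e : Module.Basis (Fin 7) ℂ (Fin 7 → ℂ)) (i j k : Fin 7) :
    wedge₃ e i k j = -wedge₃ e i j k := by
  rw [wedge₃, wedge₃, ← AlternatingMap.map_swap _ _ (i := 1) (j := 2) (by decide)]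
  congr 1
  funext l
  fin_cases l <;> simp [Equiv.swap_apply_def]

theorem wedge₃_self (e : Module.Basis (Fin 7) ℂ (Fin 7 → ℂ)) (i k : Fin 7) :
    wedge₃ e i i k = 0 :=
  AlternatingMap.map_eq_zero_of_eq _ _ (i := 0) (j := 1) (by simp) (by decide)

theorem wedge₃_self_right (e : Module.Basis (Fin 7) ℂ (Fin 7 → ℂ)) (i k : Fin 7) :
    wedge₃ e i k k = 0 :=
  AlternatingMap.map_eq_zero_of_eq _ _ (i := 1) (j := 2) (by simp) (by decide)

/-- To prove that the basis trivectors with indices satisfying a symmetric condition lie in a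
subspace, increasing indices suffice. -/
theorem wedge₃_mem_of_lt (e : Module.Basis (Fin 7) ℂ (Fin 7 → ℂ))
    (T : Submodule ℂ (⋀[ℂ]^3 (Fin 7 → ℂ))) (R : Fin 7 → Fin 7 → Fin 7 → Prop)
    (hl : ∀ i j k, R i j k → R j i k) (hr : ∀ i j k, R i j k → R i k j)
    (h : ∀ i j k, i < j → j < k → R i j k → wedge₃ e i j k ∈ T) (i j k : Fin 7) (hR : R i j k) :
    wedge₃ e i j k ∈ T := by
  have key : ∀ i j k, i < j → R i j k → wedge₃ e i j k ∈ T := by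
    intro i j k hij hR
    rcases lt_trichotomy j k with hjk | rfl | hjk
    · exact h i j k hij hjk hR
    · rw [wedge₃_self_right]; exact T.zero_mem
    · rw [wedge₃_swap_right, T.neg_mem_iff]
      have hR' := hr _ _ _ hR
      rcases lt_trichotomy i k with hik | rfl | hik
      · exact h i k j hik hjk hR'
      · rw [wedge₃_self]; exact T.zero_mem
      · rw [wedge₃_swap_left, T.neg_mem_iff]
        exact h k i j hik hij (hl _ _ _ hR')
  rcases lt_trichotomy i j with hij | rfl | hij
  · exact key i j k hij hR
  · rw [wedge₃_self]; exact T.zero_mem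
  · rw [wedge₃_swap_left, T.neg_mem_iff]
    exact key j i k hij (hl _ _ _ hR)

theorem ιMulti_comp_eq_wedge₃ (e : Module.Basis (Fin 7) ℂ (Fin 7 → ℂ)) (r : Fin 3 → Fin 7) :
    exteriorPower.ιMulti ℂ 3 (e ∘ r) = wedge₃ e (r 0) (r 1) (r 2) := by
  rw [wedge₃]
  congr 1
  funext l
  fin_cases l <;> rfl

theorem update_vec₃_zero {α : Type*} (a b c x : α) :
    Function.update ![a, b, c] 0 x = ![x, b, c] := by
  funext l
  fin_cases l <;> rfl

theorem update_vec₃_one {α : Type*} (a b c x : α) :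
    Function.update ![a, b, c] 1 x = ![a, x, c] := by
  funext l
  fin_cases l <;> rfl

theorem update_vec₃_two {α : Type*} (a b c x : α) :
    Function.update ![a, b, c] 2 x = ![a, b, x] := by
  funext l
  fin_cases l <;> rfl

theorem ιMulti_add_left (a a' b c : Fin 7 → ℂ) :
    exteriorPower.ιMulti ℂ 3 ![a + a', b, c] =
      exteriorPower.ιMulti ℂ 3 ![a, b, c] + exteriorPower.ιMulti ℂ 3 ![a', b, c] := by
  simpa only [update_vec₃_zero] using
    (exteriorPower.ιMulti ℂ 3).map_update_add ![a, b, c] 0 a a'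

theorem ιMulti_add_middle (a b b' c : Fin 7 → ℂ) :
    exteriorPower.ιMulti ℂ 3 ![a, b + b', c] =
      exteriorPower.ιMulti ℂ 3 ![a, b, c] + exteriorPower.ιMulti ℂ 3 ![a, b', c] := by
  simpa only [update_vec₃_one] using
    (exteriorPower.ιMulti ℂ 3).map_update_add ![a, b, c] 1 b b'

/-- Sums of two decomposable trivectors are dense in the third exterior power of a hyperplane. -/
theorem polyEval_eq_zero_of_mem_hyperplane (e : Module.Basis (Fin 7) ℂ (Fin 7 → ℂ))
    (f : MvPolynomial (Module.Dual ℂ (⋀[ℂ]^3 (Fin 7 → ℂ))) ℂ)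
    (hf : ∀ v : Fin 2 → Fin 3 → (Fin 7 → ℂ),
      polyEval f (∑ i, exteriorPower.ιMulti ℂ 3 (v i)) = 0)
    {ω : ⋀[ℂ]^3 (Fin 7 → ℂ)}
    (hω : ω ∈ Submodule.span ℂ {y | ∃ i j k, i < j ∧ j < k ∧ k < 6 ∧ y = wedge₃ e i j k}) :
    polyEval f ω = 0 := by
  -- Of three distinct indices below 6, two lie in {0, 1, 2} or two lie in {3, 4, 5}. So every basis
  -- trivector arises, up to sign, by changing one factor of one of the two summands.
  refine polyEval_eq_zero_of_mem_span_basis e (fun _ => {0, 1, 2, 3, 4, 5})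
    ![![e 0, e 1, e 2], ![e 3, e 4, e 5]] ?_ ?_ f hf (Submodule.span_mono ?_ hω)
  · intro i j
    fin_cases i <;> fin_cases j <;>
      exact Submodule.subset_span (Set.mem_image_of_mem _ (by decide))
  · set T := Submodule.span ℂ {y | ∃ i j, ∃ k ∈ ({0, 1, 2, 3, 4, 5} : Finset (Fin 7)),
      y = exteriorPower.ιMulti ℂ 3 (Function.update
        (![![e 0, e 1, e 2], ![e 3, e 4, e 5]] i : Fin 3 → Fin 7 → ℂ) j (e k))} with hT
    have F : ∀ i j k, k ∈ ({0, 1, 2, 3, 4, 5} : Finset (Fin 7)) →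
        exteriorPower.ιMulti ℂ 3 (Function.update
          (![![e 0, e 1, e 2], ![e 3, e 4, e 5]] i : Fin 3 → Fin 7 → ℂ) j (e k)) ∈ T :=
      fun i j k hk => Submodule.subset_span ⟨i, j, k, hk, rfl⟩
    have a0 : ∀ k ∈ ({0, 1, 2, 3, 4, 5} : Finset (Fin 7)), wedge₃ e k 1 2 ∈ T := fun k hk => by
      simpa [wedge₃, update_vec₃_zero] using F 0 0 k hk
    have a1 : ∀ k ∈ ({0, 1, 2, 3, 4, 5} : Finset (Fin 7)), wedge₃ e 0 k 2 ∈ T := fun k hk => by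
      simpa [wedge₃, update_vec₃_one] using F 0 1 k hk
    have a2 : ∀ k ∈ ({0, 1, 2, 3, 4, 5} : Finset (Fin 7)), wedge₃ e 0 1 k ∈ T := fun k hk => by
      simpa [wedge₃, update_vec₃_two] using F 0 2 k hk
    have b0 : ∀ k ∈ ({0, 1, 2, 3, 4, 5} : Finset (Fin 7)), wedge₃ e k 4 5 ∈ T := fun k hk => by
      simpa [wedge₃, update_vec₃_zero] using F 1 0 k hk
    have b1 : ∀ k ∈ ({0, 1, 2, 3, 4, 5} : Finset (Fin 7)), wedge₃ e 3 k 5 ∈ T := fun k hk => by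
      simpa [wedge₃, update_vec₃_one] using F 1 1 k hk
    have b2 : ∀ k ∈ ({0, 1, 2, 3, 4, 5} : Finset (Fin 7)), wedge₃ e 3 4 k ∈ T := fun k hk => by
      simpa [wedge₃, update_vec₃_two] using F 1 2 k hk
    clear_value T
    replace a0 : ∀ k ∈ ({0, 1, 2, 3, 4, 5} : Finset (Fin 7)), wedge₃ e 1 2 k ∈ T := fun k hk => by
      rw [wedge₃_swap_right, wedge₃_swap_left, neg_neg]; exact a0 k hk
    replace a1 : ∀ k ∈ ({0, 1, 2, 3, 4, 5} : Finset (Fin 7)), wedge₃ e 0 2 k ∈ T := fun k hk => by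
      rw [wedge₃_swap_right, T.neg_mem_iff]; exact a1 k hk
    replace b1 : ∀ k ∈ ({0, 1, 2, 3, 4, 5} : Finset (Fin 7)), wedge₃ e k 3 5 ∈ T := fun k hk => by
      rw [wedge₃_swap_left, T.neg_mem_iff]; exact b1 k hk
    replace b2 : ∀ k ∈ ({0, 1, 2, 3, 4, 5} : Finset (Fin 7)), wedge₃ e k 3 4 ∈ T := fun k hk => by
      rw [wedge₃_swap_left, wedge₃_swap_right, neg_neg]; exact b2 k hk
    intro r hr
    rw [ιMulti_comp_eq_wedge₃]
    refine wedge₃_mem_of_lt e T (fun i j k => i < 6 ∧ j < 6 ∧ k < 6) (by tauto) (by tauto) ?_ _ _ _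
      ⟨?_, ?_, ?_⟩
    · intro i j k hij hjk hR
      have h : (i = 0 ∧ j = 1) ∨ (i = 0 ∧ j = 2) ∨ (i = 1 ∧ j = 2) ∨ (j = 4 ∧ k = 5) ∨
        (j = 3 ∧ k = 5) ∨ (j = 3 ∧ k = 4) := by revert i j k; decide
      have hm : ∀ k : Fin 7, k < 6 → k ∈ ({0, 1, 2, 3, 4, 5} : Finset (Fin 7)) := by decide
      rcases h with ⟨rfl, rfl⟩ | ⟨rfl, rfl⟩ | ⟨rfl, rfl⟩ | ⟨rfl, rfl⟩ | ⟨rfl, rfl⟩ | ⟨rfl, rfl⟩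
      exacts [a2 _ (hm _ hR.2.2), a1 _ (hm _ hR.2.2), a0 _ (hm _ hR.2.2), b0 _ (hm _ hR.1),
        b1 _ (hm _ hR.1), b2 _ (hm _ hR.1)]
    all_goals
      have hm : ∀ k ∈ ({0, 1, 2, 3, 4, 5} : Finset (Fin 7)), k < 6 := by decide
      exact hm _ (hr _)
  · rintro _ ⟨i, j, k, hij, hjk, hk, rfl⟩
    refine ⟨![i, j, k], ?_, (ιMulti_comp_eq_wedge₃ e ![i, j, k]).symm⟩
    have hm : ∀ k : Fin 7, k < 6 → k ∈ ({0, 1, 2, 3, 4, 5} : Finset (Fin 7)) := by decide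
    intro l
    fin_cases l
    exacts [hm _ (hij.trans (hjk.trans hk)), hm _ (hjk.trans hk), hm _ hk]

/-- Sums of three decomposable trivectors are dense in `⋀² W ∧ V` for `W` of dimension four. -/
theorem polyEval_eq_zero_of_mem_fourSpace (e : Module.Basis (Fin 7) ℂ (Fin 7 → ℂ))
    (f : MvPolynomial (Module.Dual ℂ (⋀[ℂ]^3 (Fin 7 → ℂ))) ℂ)
    (hf : ∀ v : Fin 3 → Fin 3 → (Fin 7 → ℂ),
      polyEval f (∑ i, exteriorPower.ιMulti ℂ 3 (v i)) = 0)
    {ω : ⋀[ℂ]^3 (Fin 7 → ℂ)}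
    (hω : ω ∈ Submodule.span ℂ {y | ∃ i j k, i < j ∧ j < k ∧ j < 4 ∧ y = wedge₃ e i j k}) :
    polyEval f ω = 0 := by
  -- The first two factors vary in W, the last one in V. The products of e₀ ∧ e₁ and e₂ ∧ e₃ with
  -- any vector come from the first two summands. For each of e₄, e₅, e₆ the other four basis
  -- bivectors of W come, modulo these, from the summand ending in that vector.
  refine polyEval_eq_zero_of_mem_span_basis e ![{0, 1, 2, 3}, {0, 1, 2, 3}, Finset.univ]
    ![![e 0, e 1, e 4], ![e 2, e 3, e 5], ![e 0 + e 2, e 1 + e 3, e 6]] ?_ ?_ f hf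
    (Submodule.span_mono ?_ hω)
  · intro i j
    fin_cases i <;> fin_cases j <;>
      first
      | exact Submodule.subset_span (Set.mem_image_of_mem _ (by decide))
      | exact Submodule.add_mem _ (Submodule.subset_span (Set.mem_image_of_mem _ (by decide)))
          (Submodule.subset_span (Set.mem_image_of_mem _ (by decide)))
  · set T := Submodule.span ℂ {y | ∃ i j,
      ∃ k ∈ (![{0, 1, 2, 3}, {0, 1, 2, 3}, Finset.univ] j : Finset (Fin 7)),
      y = exteriorPower.ιMulti ℂ 3 (Function.update
        (![![e 0, e 1, e 4], ![e 2, e 3, e 5], ![e 0 + e 2, e 1 + e 3, e 6]] i :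
          Fin 3 → Fin 7 → ℂ) j (e k))} with hT
    have F : ∀ i j k, k ∈ (![{0, 1, 2, 3}, {0, 1, 2, 3}, Finset.univ] j : Finset (Fin 7)) →
        exteriorPower.ιMulti ℂ 3 (Function.update
          (![![e 0, e 1, e 4], ![e 2, e 3, e 5], ![e 0 + e 2, e 1 + e 3, e 6]] i :
            Fin 3 → Fin 7 → ℂ) j (e k)) ∈ T :=
      fun i j k hk => Submodule.subset_span ⟨i, j, k, hk, rfl⟩
    have a0 : ∀ k ∈ ({0, 1, 2, 3} : Finset (Fin 7)), wedge₃ e k 1 4 ∈ T := fun k hk => by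
      simpa [wedge₃, update_vec₃_zero] using F 0 0 k hk
    have a1 : ∀ k ∈ ({0, 1, 2, 3} : Finset (Fin 7)), wedge₃ e 0 k 4 ∈ T := fun k hk => by
      simpa [wedge₃, update_vec₃_one] using F 0 1 k hk
    have a2 : ∀ k, wedge₃ e 0 1 k ∈ T := fun k => by
      simpa [wedge₃, update_vec₃_two] using F 0 2 k (Finset.mem_univ k)
    have b0 : ∀ k ∈ ({0, 1, 2, 3} : Finset (Fin 7)), wedge₃ e k 3 5 ∈ T := fun k hk => by
      simpa [wedge₃, update_vec₃_zero] using F 1 0 k hk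
    have b1 : ∀ k ∈ ({0, 1, 2, 3} : Finset (Fin 7)), wedge₃ e 2 k 5 ∈ T := fun k hk => by
      simpa [wedge₃, update_vec₃_one] using F 1 1 k hk
    have b2 : ∀ k, wedge₃ e 2 3 k ∈ T := fun k => by
      simpa [wedge₃, update_vec₃_two] using F 1 2 k (Finset.mem_univ k)
    have c0 : ∀ k ∈ ({0, 1, 2, 3} : Finset (Fin 7)), wedge₃ e k 1 6 + wedge₃ e k 3 6 ∈ T :=
      fun k hk => by
        simpa [wedge₃, update_vec₃_zero, ιMulti_add_middle] using F 2 0 k hk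
    have c1 : ∀ k ∈ ({0, 1, 2, 3} : Finset (Fin 7)), wedge₃ e 0 k 6 + wedge₃ e 2 k 6 ∈ T :=
      fun k hk => by
        simpa [wedge₃, update_vec₃_one, ιMulti_add_left] using F 2 1 k hk
    have c2 : ∀ k, wedge₃ e 0 1 k + wedge₃ e 2 1 k + (wedge₃ e 0 3 k + wedge₃ e 2 3 k) ∈ T :=
      fun k => by
        simpa [wedge₃, update_vec₃_two, ιMulti_add_left, ιMulti_add_middle] using
          F 2 2 k (Finset.mem_univ k)
    clear_value T
    have h026 : wedge₃ e 0 2 6 ∈ T := by simpa [wedge₃_self] using c1 2 (by decide)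
    have h136 : wedge₃ e 1 3 6 ∈ T := by simpa [wedge₃_self] using c0 1 (by decide)
    have h036 : wedge₃ e 0 3 6 ∈ T := by
      simpa using T.sub_mem (c0 0 (by decide)) (a2 6)
    have h126 : wedge₃ e 1 2 6 ∈ T := by
      rw [wedge₃_swap_left, T.neg_mem_iff]
      have := T.sub_mem (T.sub_mem (T.sub_mem (c2 6) (a2 6)) (b2 6)) h036
      convert this using 1
      abel
    have h023 : wedge₃ e 0 2 3 ∈ T := by
      rw [wedge₃_swap_left, wedge₃_swap_right, neg_neg]; exact b2 0
    have h123 : wedge₃ e 1 2 3 ∈ T := by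
      rw [wedge₃_swap_left, wedge₃_swap_right, neg_neg]; exact b2 1
    have h134 : wedge₃ e 1 3 4 ∈ T := by
      rw [wedge₃_swap_left, T.neg_mem_iff]; exact a0 3 (by decide)
    have h124 : wedge₃ e 1 2 4 ∈ T := by
      rw [wedge₃_swap_left, T.neg_mem_iff]; exact a0 2 (by decide)
    have h025 : wedge₃ e 0 2 5 ∈ T := by
      rw [wedge₃_swap_left, T.neg_mem_iff]; exact b1 0 (by decide)
    have h125 : wedge₃ e 1 2 5 ∈ T := by
      rw [wedge₃_swap_left, T.neg_mem_iff]; exact b1 1 (by decide)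
    intro r hr
    rw [ιMulti_comp_eq_wedge₃]
    refine wedge₃_mem_of_lt e T
      (fun i j k => (i < 4 ∧ j < 4) ∨ (i < 4 ∧ k < 4) ∨ (j < 4 ∧ k < 4))
      (by tauto) (by tauto) ?_ _ _ _ ?_
    · intro i j k hij hjk hR
      have h : (i = 0 ∧ j = 1) ∨ (i = 2 ∧ j = 3) ∨
        (i = 0 ∧ j = 2 ∧ (k = 3 ∨ k = 4 ∨ k = 5 ∨ k = 6)) ∨
        (i = 0 ∧ j = 3 ∧ (k = 4 ∨ k = 5 ∨ k = 6)) ∨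
        (i = 1 ∧ j = 2 ∧ (k = 3 ∨ k = 4 ∨ k = 5 ∨ k = 6)) ∨
        (i = 1 ∧ j = 3 ∧ (k = 4 ∨ k = 5 ∨ k = 6)) := by revert i j k; decide
      rcases h with ⟨rfl, rfl⟩ | ⟨rfl, rfl⟩ | ⟨rfl, rfl, rfl | rfl | rfl | rfl⟩ |
        ⟨rfl, rfl, rfl | rfl | rfl⟩ | ⟨rfl, rfl, rfl | rfl | rfl | rfl⟩ |
        ⟨rfl, rfl, rfl | rfl | rfl⟩
      exacts [a2 _, b2 _, h023, a1 2 (by decide), h025, h026, a1 3 (by decide), b0 0 (by decide),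
        h036, h123, h124, h125, h126, h134, b0 1 (by decide), h136]
    · have hm : ∀ k ∈ ({0, 1, 2, 3} : Finset (Fin 7)), k < 4 := by decide
      exact Or.inl ⟨hm _ (hr 0), hm _ (hr 1)⟩
  · rintro _ ⟨i, j, k, hij, hjk, hk, rfl⟩
    refine ⟨![i, j, k], ?_, (ιMulti_comp_eq_wedge₃ e ![i, j, k]).symm⟩
    have hm : ∀ k : Fin 7, k < 4 → k ∈ ({0, 1, 2, 3} : Finset (Fin 7)) := by decide
    intro l
    fin_cases l
    exacts [hm _ (hij.trans hk), hm _ hk, Finset.mem_univ _]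

/-- Sums of three decomposable trivectors are dense in `U ∧ ⋀² V` for `U` of dimension two. -/
theorem polyEval_eq_zero_of_mem_twoSpace (e : Module.Basis (Fin 7) ℂ (Fin 7 → ℂ))
    (f : MvPolynomial (Module.Dual ℂ (⋀[ℂ]^3 (Fin 7 → ℂ))) ℂ)
    (hf : ∀ v : Fin 3 → Fin 3 → (Fin 7 → ℂ),
      polyEval f (∑ i, exteriorPower.ιMulti ℂ 3 (v i)) = 0)
    {ω : ⋀[ℂ]^3 (Fin 7 → ℂ)}
    (hω : ω ∈ Submodule.span ℂ {y | ∃ i j k, i < j ∧ j < k ∧ i < 2 ∧ y = wedge₃ e i j k}) :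
    polyEval f ω = 0 := by
  -- The first factor varies in U, the others in V. The first two summands yield all basis
  -- trivectors except those with indices 016, 046, 056, 126, 136, and the third summand supplies
  -- these five.
  refine polyEval_eq_zero_of_mem_span_basis e ![{0, 1}, Finset.univ, Finset.univ]
    ![![e 0, e 2, e 3], ![e 1, e 4, e 5], ![e 0 + e 1, e 2 + e 4, e 6]] ?_ ?_ f hf
    (Submodule.span_mono ?_ hω)
  · intro i j
    fin_cases i <;> fin_cases j <;>
      first
      | exact Submodule.subset_span (Set.mem_image_of_mem _ (by decide))
      | exact Submodule.add_mem _ (Submodule.subset_span (Set.mem_image_of_mem _ (by decide)))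
          (Submodule.subset_span (Set.mem_image_of_mem _ (by decide)))
  · set T := Submodule.span ℂ {y | ∃ i j,
      ∃ k ∈ (![{0, 1}, Finset.univ, Finset.univ] j : Finset (Fin 7)),
      y = exteriorPower.ιMulti ℂ 3 (Function.update
        (![![e 0, e 2, e 3], ![e 1, e 4, e 5], ![e 0 + e 1, e 2 + e 4, e 6]] i :
          Fin 3 → Fin 7 → ℂ) j (e k))} with hT
    have F : ∀ i j k, k ∈ (![{0, 1}, Finset.univ, Finset.univ] j : Finset (Fin 7)) →
        exteriorPower.ιMulti ℂ 3 (Function.update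
          (![![e 0, e 2, e 3], ![e 1, e 4, e 5], ![e 0 + e 1, e 2 + e 4, e 6]] i :
            Fin 3 → Fin 7 → ℂ) j (e k)) ∈ T :=
      fun i j k hk => Submodule.subset_span ⟨i, j, k, hk, rfl⟩
    have h123 : wedge₃ e 1 2 3 ∈ T := by
      simpa [wedge₃, update_vec₃_zero] using F 0 0 1 (by decide)
    have a1 : ∀ k, wedge₃ e 0 k 3 ∈ T := fun k => by
      simpa [wedge₃, update_vec₃_one] using F 0 1 k (Finset.mem_univ k)
    have a2 : ∀ k, wedge₃ e 0 2 k ∈ T := fun k => by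
      simpa [wedge₃, update_vec₃_two] using F 0 2 k (Finset.mem_univ k)
    have h045 : wedge₃ e 0 4 5 ∈ T := by
      simpa [wedge₃, update_vec₃_zero] using F 1 0 0 (by decide)
    have b1 : ∀ k, wedge₃ e 1 k 5 ∈ T := fun k => by
      simpa [wedge₃, update_vec₃_one] using F 1 1 k (Finset.mem_univ k)
    have b2 : ∀ k, wedge₃ e 1 4 k ∈ T := fun k => by
      simpa [wedge₃, update_vec₃_two] using F 1 2 k (Finset.mem_univ k)
    have c0 : ∀ k ∈ ({0, 1} : Finset (Fin 7)), wedge₃ e k 2 6 + wedge₃ e k 4 6 ∈ T :=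
      fun k hk => by
        simpa [wedge₃, update_vec₃_zero, ιMulti_add_middle] using F 2 0 k hk
    have c1 : ∀ k, wedge₃ e 0 k 6 + wedge₃ e 1 k 6 ∈ T :=
      fun k => by
        simpa [wedge₃, update_vec₃_one, ιMulti_add_left] using F 2 1 k (Finset.mem_univ k)
    clear_value T
    have h034 : wedge₃ e 0 3 4 ∈ T := by rw [wedge₃_swap_right, T.neg_mem_iff]; exact a1 4
    have h035 : wedge₃ e 0 3 5 ∈ T := by rw [wedge₃_swap_right, T.neg_mem_iff]; exact a1 5
    have h036 : wedge₃ e 0 3 6 ∈ T := by rw [wedge₃_swap_right, T.neg_mem_iff]; exact a1 6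
    have h046 : wedge₃ e 0 4 6 ∈ T := by
      simpa using T.sub_mem (c0 0 (by decide)) (a2 6)
    have h126 : wedge₃ e 1 2 6 ∈ T := by
      simpa using T.sub_mem (c0 1 (by decide)) (b2 6)
    have h156 : wedge₃ e 1 5 6 ∈ T := by rw [wedge₃_swap_right, T.neg_mem_iff]; exact b1 6
    have h056 : wedge₃ e 0 5 6 ∈ T := by simpa using T.sub_mem (c1 5) h156
    have h136 : wedge₃ e 1 3 6 ∈ T := by simpa using T.sub_mem (c1 3) h036
    have h016 : wedge₃ e 0 1 6 ∈ T := by simpa [wedge₃_self] using c1 1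
    have h015 : wedge₃ e 0 1 5 ∈ T := by rw [wedge₃_swap_left, T.neg_mem_iff]; exact b1 0
    have h014 : wedge₃ e 0 1 4 ∈ T := by
      rw [wedge₃_swap_left, wedge₃_swap_right, neg_neg]; exact b2 0
    have h012 : wedge₃ e 0 1 2 ∈ T := by rw [wedge₃_swap_right, T.neg_mem_iff]; exact a2 1
    have h124 : wedge₃ e 1 2 4 ∈ T := by rw [wedge₃_swap_right, T.neg_mem_iff]; exact b2 2
    have h134 : wedge₃ e 1 3 4 ∈ T := by rw [wedge₃_swap_right, T.neg_mem_iff]; exact b2 3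
    intro r hr
    rw [ιMulti_comp_eq_wedge₃]
    refine wedge₃_mem_of_lt e T (fun i j k => i < 2 ∨ j < 2 ∨ k < 2)
      (by tauto) (by tauto) ?_ _ _ _ ?_
    · intro i j k hij hjk hR
      have h : i = 0 ∨ i = 1 := by revert i j k; decide
      clear hR
      rcases h with rfl | rfl
      · have h : j = 2 ∨ (j = 1 ∧ (k = 2 ∨ k = 3 ∨ k = 4 ∨ k = 5 ∨ k = 6)) ∨
          (j = 3 ∧ (k = 4 ∨ k = 5 ∨ k = 6)) ∨ (j = 4 ∧ (k = 5 ∨ k = 6)) ∨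
          (j = 5 ∧ k = 6) := by revert j k; decide
        rcases h with rfl | ⟨rfl, rfl | rfl | rfl | rfl | rfl⟩ |
          ⟨rfl, rfl | rfl | rfl⟩ | ⟨rfl, rfl | rfl⟩ | ⟨rfl, rfl⟩
        exacts [a2 _, h012, a1 1, h014, h015, h016, h034, h035, h036, h045, h046, h056]
      · have h : j = 4 ∨ (j = 2 ∧ (k = 3 ∨ k = 4 ∨ k = 5 ∨ k = 6)) ∨
          (j = 3 ∧ (k = 4 ∨ k = 5 ∨ k = 6)) ∨ (j = 5 ∧ k = 6) := by revert j k; decide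
        rcases h with rfl | ⟨rfl, rfl | rfl | rfl | rfl⟩ | ⟨rfl, rfl | rfl | rfl⟩ | ⟨rfl, rfl⟩
        exacts [b2 _, h123, h124, b1 2, h126, h134, b1 3, h136, h156]
    · have hm : ∀ k ∈ ({0, 1} : Finset (Fin 7)), k < 2 := by decide
      exact Or.inl (hm _ (hr 0))
  · rintro _ ⟨i, j, k, hij, hjk, hk, rfl⟩
    refine ⟨![i, j, k], ?_, (ιMulti_comp_eq_wedge₃ e ![i, j, k]).symm⟩
    have hm : ∀ k : Fin 7, k < 2 → k ∈ ({0, 1} : Finset (Fin 7)) := by decide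
    intro l
    fin_cases l
    exacts [hm _ hk, Finset.mem_univ _, Finset.mem_univ _]

/-! ### Rank and minors. -/

/-- A family spanning a space of dimension at least `k` has `k` linearly independent members, which
may be taken in their order. -/
theorem exists_orderEmbedding_linearIndependent {K M : Type*} [Field K] [AddCommGroup M]
    [Module K M] {m k : ℕ} (v : Fin m → M)
    (h : k ≤ Module.finrank K (Submodule.span K (Set.range v))) :
    ∃ s : Fin k ↪o Fin m, LinearIndependent K (v ∘ s) := by
  classical
  have : Module.Finite K (Submodule.span K (Set.range v)) :=
    Module.Finite.span_of_finite K (Set.finite_range v)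
  obtain ⟨f, hf, -, hli⟩ := Submodule.exists_fun_fin_finrank_span_eq K (Set.range v)
  choose g hg using hf
  have hfg : f = v ∘ g := funext fun i => (hg i).symm
  have hginj : Function.Injective g := fun i j hij =>
    hli.injective (by rw [hfg]; simp [hij])
  let T : Finset (Fin m) := Finset.univ.image fun i : Fin k => g (Fin.castLE h i)
  have hT : T.card = k := by
    rw [show T = Finset.univ.image (g ∘ Fin.castLE h) from rfl,
      Finset.card_image_of_injective _ (hginj.comp (Fin.castLE_injective h))]
    simp
  refine ⟨T.orderEmbOfFin hT, ?_⟩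
  have hmem : ∀ i, ∃ j, g j = T.orderEmbOfFin hT i := fun i => by
    obtain ⟨j, -, hj⟩ := Finset.mem_image.1 (T.orderEmbOfFin_mem hT i)
    exact ⟨_, hj⟩
  choose σ hσ using hmem
  have : v ∘ T.orderEmbOfFin hT = f ∘ σ := by
    funext i
    simp [hfg, hσ]
  rw [this]
  refine hli.comp σ fun i j hij => (T.orderEmbOfFin hT).injective ?_
  rw [← hσ, ← hσ, hij]

/-- A matrix has rank at most `r` if and only if its minors of size `r + 1` vanish. -/
theorem rank_le_iff_minors {K : Type*} [Field K] {m n r : ℕ} (A : Matrix (Fin m) (Fin n) K) :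
    A.rank ≤ r ↔ ∀ (s : Fin (r + 1) ↪o Fin m) (t : Fin (r + 1) ↪o Fin n),
      (A.submatrix s t).det = 0 := by
  constructor
  · intro h s t
    by_contra hd
    have h1 := Matrix.rank_of_det_ne_zero hd
    have h2 := A.rank_submatrix_le s t
    rw [h1, Fintype.card_fin] at h2
    omega
  · intro h
    by_contra! hr
    -- Independent rows are selected first, then independent columns of the submatrix formed by
    -- these rows.
    obtain ⟨s, hs⟩ := exists_orderEmbedding_linearIndependent (k := r + 1) A.row
      (by rw [← Matrix.rank_eq_finrank_span_row]; exact hr)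
    have hrank : (A.submatrix s id).transpose.rank = r + 1 := by
      rw [Matrix.rank_transpose]
      simpa using LinearIndependent.rank_matrix (M := A.submatrix s id) hs
    obtain ⟨t, ht⟩ := exists_orderEmbedding_linearIndependent (k := r + 1)
      (A.submatrix s id).transpose.row
      (by rw [← Matrix.rank_eq_finrank_span_row, hrank])
    have hu : IsUnit (A.submatrix s t).transpose := by
      rw [← Matrix.linearIndependent_rows_iff_isUnit]
      exact ht
    rw [Matrix.isUnit_iff_isUnit_det, Matrix.det_transpose, h s t] at hu
    simp at hu

theorem finrank_range_le_iff_minors {K M N : Type*} [Field K] [AddCommGroup M] [Module K M]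
    [AddCommGroup N] [Module K N] {m n r : ℕ} (b : Module.Basis (Fin n) K M)
    (c : Module.Basis (Fin m) K N) (φ : M →ₗ[K] N) :
    Module.finrank K (LinearMap.range φ) ≤ r ↔
      ∀ (s : Fin (r + 1) ↪o Fin m) (t : Fin (r + 1) ↪o Fin n),
        ((LinearMap.toMatrix b c φ).submatrix s t).det = 0 := by
  rw [← rank_le_iff_minors, Matrix.rank_eq_finrank_range_toLin _ c b, Matrix.toLin_toMatrix]

/-! ### Cones over secant varieties in terms of sums of decomposables. -/

section Projective

variable {W : Type*} [AddCommGroup W] [Module ℂ W]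

theorem polyEval_smul {f : MvPolynomial (Module.Dual ℂ W) ℂ} {d : ℕ} (hf : f.IsHomogeneous d)
    (c : ℂ) (w : W) : polyEval f (c • w) = c ^ d * polyEval f w := by
  unfold polyEval
  simp only [MvPolynomial.eval_eq, Finset.mul_sum, map_smul, smul_eq_mul, mul_pow,
    Finset.prod_mul_distrib, Finset.prod_pow_eq_pow_sum]
  refine Finset.sum_congr rfl fun x hx => ?_
  rw [hf.degree_eq_sum_deg_support hx]
  ring

theorem rep_mem_span_of_mem_span {ι : Type*} (Q : ι → ℙ ℂ W) {P : ℙ ℂ W}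
    (hP : P ∈ Projectivization.Subspace.span (Set.range Q)) :
    P.rep ∈ Submodule.span ℂ (Set.range fun i => (Q i).rep) := by
  have h : Projectivization.Subspace.span (Set.range Q) ≤
      (Submodule.span ℂ (Set.range fun i => (Q i).rep)).projectivization := by
    rw [Projectivization.Subspace.span_le_subspace_iff]
    rintro _ ⟨i, rfl⟩
    have : Projectivization.mk ℂ (Q i).rep (Q i).rep_nonzero ∈
        (Submodule.span ℂ (Set.range fun i => (Q i).rep)).projectivization := by
      rw [Submodule.mk_mem_projectivization_iff]
      exact Submodule.subset_span ⟨i, rfl⟩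
    rwa [Projectivization.mk_rep] at this
  have := h hP
  rwa [← P.mk_rep, Submodule.mk_mem_projectivization_iff] at this

theorem mk_mem_span_of_mem_span {ι : Type*} (Q : ι → ℙ ℂ W) {w : W} (hw : w ≠ 0)
    (h : w ∈ Submodule.span ℂ (Set.range fun i => (Q i).rep)) :
    Projectivization.mk ℂ w hw ∈ Projectivization.Subspace.span (Set.range Q) := by
  rw [← Projectivization.Subspace.mem_submodule_iff]
  refine (Submodule.span_le.2 ?_) h
  rintro _ ⟨i, rfl⟩
  simp only [SetLike.mem_coe]
  rw [Projectivization.Subspace.mem_submodule_iff _ (Q i).rep_nonzero, Projectivization.mk_rep]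
  exact Projectivization.Subspace.subset_span _ ⟨i, rfl⟩

end Projective

theorem exists_rep_eq_ιMulti {k n : ℕ} {Q : ℙ ℂ (⋀[ℂ]^(k + 1) (Fin (n + 1) → ℂ))}
    (hQ : Q ∈ Gr k n) (c : ℂ) : ∃ v, c • Q.rep = exteriorPower.ιMulti ℂ (k + 1) v := by
  obtain ⟨v, -, hv⟩ := hQ
  have : Q.rep ∈ Q.submodule := by
    rw [Q.submodule_eq]; exact Submodule.mem_span_singleton_self _
  rw [hv, Submodule.mem_span_singleton] at this
  obtain ⟨a, ha⟩ := this
  refine ⟨Function.update v 0 ((c * a) • v 0), ?_⟩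
  rw [AlternatingMap.map_update_smul, Function.update_eq_self, ← ha, smul_smul]

theorem mk_ιMulti_mem_Gr {k n : ℕ} (v : Fin (k + 1) → Fin (n + 1) → ℂ)
    (hv : exteriorPower.ιMulti ℂ (k + 1) v ≠ 0) :
    Projectivization.mk ℂ (exteriorPower.ιMulti ℂ (k + 1) v) hv ∈ Gr k n := by
  refine ⟨v, ?_, Projectivization.submodule_mk _ _⟩
  by_contra h
  exact hv ((exteriorPower.ιMulti ℂ (k + 1)).map_linearDependent v h)

/-- The union of the spans of `s` points of the Grassmannian consists of the classes of sums of
`s` decomposable multivectors. -/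
theorem exists_rep_eq_sum_of_mem_span {k n s : ℕ} {Q : Fin s → Gr k n}
    {P : ℙ ℂ (⋀[ℂ]^(k + 1) (Fin (n + 1) → ℂ))}
    (hP : P ∈ Projectivization.Subspace.span
      (Set.range fun i => (Q i : ℙ ℂ (⋀[ℂ]^(k + 1) (Fin (n + 1) → ℂ))))) :
    ∃ v : Fin s → Fin (k + 1) → Fin (n + 1) → ℂ,
      P.rep = ∑ i, exteriorPower.ιMulti ℂ (k + 1) (v i) := by
  obtain ⟨c, hc⟩ := (Submodule.mem_span_range_iff_exists_fun ℂ).1 (rep_mem_span_of_mem_span _ hP)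
  choose v hv using fun i => exists_rep_eq_ιMulti (Q i).2 (c i)
  exact ⟨v, by rw [← hc]; exact Finset.sum_congr rfl fun i _ => hv i⟩

theorem exists_mk_sum_mem_span {k n s : ℕ} (v : Fin s → Fin (k + 1) → Fin (n + 1) → ℂ)
    (hv : ∑ i, exteriorPower.ιMulti ℂ (k + 1) (v i) ≠ 0) :
    ∃ Q : Fin s → Gr k n, Projectivization.mk ℂ _ hv ∈ Projectivization.Subspace.span
      (Set.range fun i => (Q i : ℙ ℂ (⋀[ℂ]^(k + 1) (Fin (n + 1) → ℂ)))) := by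
  classical
  obtain ⟨i₀, -, h₀⟩ := Finset.exists_ne_zero_of_sum_ne_zero hv
  -- A vanishing summand defines no projective point. The point of the nonzero summand `v i₀` stands
  -- in for it.
  let Q : Fin s → Gr k n := fun i =>
    if h : exteriorPower.ιMulti ℂ (k + 1) (v i) = 0 then ⟨_, mk_ιMulti_mem_Gr (v i₀) h₀⟩
    else ⟨_, mk_ιMulti_mem_Gr (v i) h⟩
  refine ⟨Q, mk_mem_span_of_mem_span _ _ (Submodule.sum_mem _ fun i _ => ?_)⟩
  by_cases h : exteriorPower.ιMulti ℂ (k + 1) (v i) = 0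
  · rw [h]; exact Submodule.zero_mem _
  · have hQ : (Q i : ℙ ℂ (⋀[ℂ]^(k + 1) (Fin (n + 1) → ℂ))) =
        Projectivization.mk ℂ (exteriorPower.ιMulti ℂ (k + 1) (v i)) h := by
      simp [Q, h]
    obtain ⟨a, ha⟩ := Projectivization.exists_smul_eq_mk_rep ℂ _ h
    rw [← inv_smul_smul a (exteriorPower.ιMulti ℂ (k + 1) (v i)), ha, ← hQ]
    exact Submodule.smul_mem _ (↑a⁻¹ : ℂ) (Submodule.subset_span ⟨i, rfl⟩)

/-- A multivector lies in the cone over the secant variety of a Grassmannian if the polynomial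
functions vanishing on sums of `s` decomposable multivectors vanish at it. -/
theorem mem_affineCone_secantVariety {k n s : ℕ} {ω : ⋀[ℂ]^(k + 1) (Fin (n + 1) → ℂ)}
    (h : ∀ f : MvPolynomial (Module.Dual ℂ (⋀[ℂ]^(k + 1) (Fin (n + 1) → ℂ))) ℂ,
      (∀ v : Fin s → Fin (k + 1) → Fin (n + 1) → ℂ,
        polyEval f (∑ i, exteriorPower.ιMulti ℂ (k + 1) (v i)) = 0) → polyEval f ω = 0)
    (hne : ω ≠ 0 → ∃ v : Fin s → Fin (k + 1) → Fin (n + 1) → ℂ,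
      ∑ i, exteriorPower.ιMulti ℂ (k + 1) (v i) ≠ 0) :
    ω ∈ affineCone (secantVariety s (Gr k n)) := by
  intro hω d f hf hQ
  have key : ∀ v : Fin s → Fin (k + 1) → Fin (n + 1) → ℂ,
      ∑ i, exteriorPower.ιMulti ℂ (k + 1) (v i) ≠ 0 →
      ∃ w : ⋀[ℂ]^(k + 1) (Fin (n + 1) → ℂ), polyEval f w = 0 ∧
        ∃ a : ℂ, a • w = ∑ i, exteriorPower.ιMulti ℂ (k + 1) (v i) := by
    intro v hv
    obtain ⟨Q, hm⟩ := exists_mk_sum_mem_span v hv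
    obtain ⟨a, ha⟩ := Projectivization.exists_smul_eq_mk_rep ℂ _ hv
    exact ⟨_, hQ _ (Set.mem_iUnion.2 ⟨Q, hm⟩), (↑a⁻¹ : ℂ), by
      rw [← ha]; exact inv_smul_smul a _⟩
  have hz : ∀ v : Fin s → Fin (k + 1) → Fin (n + 1) → ℂ,
      polyEval f (∑ i, exteriorPower.ιMulti ℂ (k + 1) (v i)) = 0 := by
    intro v
    by_cases hv : ∑ i, exteriorPower.ιMulti ℂ (k + 1) (v i) = 0
    -- The zero vector represents no point. From a vector `w` with `f(w) = 0` one gets `f(0) = 0 ^ d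
    -- * f(w) = 0`, also for `d = 0`; `hne` provides such a `w`.
    · obtain ⟨u, hu⟩ := hne hω
      obtain ⟨w, hw, -⟩ := key u hu
      rw [hv, ← zero_smul ℂ w, polyEval_smul hf, hw, mul_zero]
    · obtain ⟨w, hw, a, ha⟩ := key v hv
      rw [← ha, polyEval_smul hf, hw, mul_zero]
  obtain ⟨a, ha⟩ := Projectivization.exists_smul_eq_mk_rep ℂ ω hω
  rw [← ha]
  change polyEval f ((a : ℂ) • ω) = 0
  rw [polyEval_smul hf, h f hz, mul_zero]

/-- Representatives of points in the spans are sums of `s` decomposables, so `f` vanishes on the set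
whose closure is taken; homogeneity moves from the chosen representative to `ω`. -/
theorem polyEval_eq_zero_of_mem_affineCone {k n s : ℕ} {ω : ⋀[ℂ]^(k + 1) (Fin (n + 1) → ℂ)}
    (hω : ω ∈ affineCone (secantVariety s (Gr k n)))
    {f : MvPolynomial (Module.Dual ℂ (⋀[ℂ]^(k + 1) (Fin (n + 1) → ℂ))) ℂ} {d : ℕ}
    (hf : f.IsHomogeneous d)
    (h : ∀ v : Fin s → Fin (k + 1) → Fin (n + 1) → ℂ,
      polyEval f (∑ i, exteriorPower.ιMulti ℂ (k + 1) (v i)) = 0) : polyEval f ω = 0 := by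
  by_cases h0 : ω = 0
  · have := h fun _ => 0
    rwa [Finset.sum_eq_zero fun i _ => (exteriorPower.ιMulti ℂ (k + 1)).map_zero, ← h0] at this
  · have h1 := hω h0 d f hf (by
      intro P hP
      obtain ⟨Q, hQ⟩ := Set.mem_iUnion.1 hP
      obtain ⟨v, hv⟩ := exists_rep_eq_sum_of_mem_span hQ
      rw [hv, h])
    obtain ⟨a, ha⟩ := Projectivization.exists_smul_eq_mk_rep ℂ ω h0
    rw [← inv_smul_smul a ω, ha]
    change polyEval f ((↑a⁻¹ : ℂ) • _) = 0
    rw [polyEval_smul hf, h1, mul_zero]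

/-- If a linear family of linear maps has rank at most `r` on sums of `s` decomposable multivectors,
it has rank at most `r` on the cone over the secant variety. -/
theorem finrank_range_le_of_mem_affineCone {k n s r : ℕ} {M N : Type*} [AddCommGroup M]
    [Module ℂ M] [FiniteDimensional ℂ M] [AddCommGroup N] [Module ℂ N] [FiniteDimensional ℂ N]
    (Φ : (⋀[ℂ]^(k + 1) (Fin (n + 1) → ℂ)) →ₗ[ℂ] M →ₗ[ℂ] N)
    (h : ∀ v : Fin s → Fin (k + 1) → Fin (n + 1) → ℂ, Module.finrank ℂ
      (LinearMap.range (Φ (∑ i, exteriorPower.ιMulti ℂ (k + 1) (v i)))) ≤ r)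
    {ω : ⋀[ℂ]^(k + 1) (Fin (n + 1) → ℂ)} (hω : ω ∈ affineCone (secantVariety s (Gr k n))) :
    Module.finrank ℂ (LinearMap.range (Φ ω)) ≤ r := by
  let b := Module.finBasis ℂ M
  let c := Module.finBasis ℂ N
  rw [finrank_range_le_iff_minors b c]
  intro p q
  -- The matrix entries are linear forms in `ω`; taken as variables, they make the minor a
  -- homogeneous polynomial of degree `r + 1`.
  let l : Fin (r + 1) → Fin (r + 1) → Module.Dual ℂ (⋀[ℂ]^(k + 1) (Fin (n + 1) → ℂ)) :=
    fun i j => c.coord (p i) ∘ₗ Φ.flip (b (q j))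
  let f : MvPolynomial (Module.Dual ℂ (⋀[ℂ]^(k + 1) (Fin (n + 1) → ℂ))) ℂ :=
    (Matrix.of fun i j => MvPolynomial.X (l i j)).det
  have hf : f.IsHomogeneous (r + 1) := by
    simp only [f, Matrix.det_apply]
    refine MvPolynomial.IsHomogeneous.sum _ _ _ fun σ _ => ?_
    have hp : (∏ i, (Matrix.of fun i j => MvPolynomial.X (R := ℂ) (l i j)) (σ i) i).IsHomogeneous
        (∑ _i : Fin (r + 1), 1) :=
      MvPolynomial.IsHomogeneous.prod _ _ _ fun i _ => MvPolynomial.isHomogeneous_X _ _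
    simp only [Finset.sum_const, Finset.card_univ, Fintype.card_fin, smul_eq_mul, mul_one] at hp
    rcases Int.units_eq_one_or (Equiv.Perm.sign σ) with h1 | h1 <;> rw [h1]
    · simpa using hp
    · simpa using hp.neg
  have hev : ∀ w, polyEval f w = ((LinearMap.toMatrix b c (Φ w)).submatrix p q).det := by
    intro w
    simp only [polyEval, f]
    rw [RingHom.map_det]
    congr 1
    ext i j
    simp [l, LinearMap.toMatrix_apply]
  rw [← hev]
  refine polyEval_eq_zero_of_mem_affineCone hω hf fun v => ?_
  rw [hev]
  exact (finrank_range_le_iff_minors b c _).1 (h v) p q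

/-! ### Adapted bases and the four-form of a trivector. -/

theorem exists_basis_extending {n k : ℕ} {v : Fin k → Fin n → ℂ} (hv : LinearIndependent ℂ v) :
    ∃ (h : k ≤ n) (e : Module.Basis (Fin n) ℂ (Fin n → ℂ)), ∀ i, e (Fin.castLE h i) = v i := by
  have h : k ≤ n := by simpa using hv.fintype_card_le_finrank
  let b := Module.Basis.sumExtend hv
  have : Finite (Fin k ⊕ Module.Basis.sumExtendIndex hv) := Module.Finite.finite_basis b
  have : Finite (Module.Basis.sumExtendIndex hv) := Finite.sum_right (Fin k)
  have := Fintype.ofFinite (Module.Basis.sumExtendIndex hv)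
  have hc : Fintype.card (Module.Basis.sumExtendIndex hv) = n - k := by
    have h1 := Module.finrank_eq_card_basis b
    simp only [Module.finrank_fintype_fun_eq_card, Fintype.card_fin, Fintype.card_sum] at h1
    omega
  let ε : Fin k ⊕ Module.Basis.sumExtendIndex hv ≃ Fin n :=
    ((Equiv.refl _).sumCongr (Fintype.equivFinOfCardEq hc)).trans
      (finSumFinEquiv.trans (finCongr (by omega)))
  refine ⟨h, b.reindex ε, fun i => ?_⟩
  have : ε.symm (Fin.castLE h i) = Sum.inl i := by
    rw [Equiv.symm_apply_eq]
    ext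
    simp [ε]
  rw [Module.Basis.reindex_apply, this]
  simp only [b, Module.Basis.sumExtend, Module.Basis.reindex_apply, Module.Basis.extend_apply_self]
  rfl

/-- The functional on the exterior algebra of `ℂ⁷` which is the determinant in degree seven and zero
in the other degrees. -/
def vol : ExteriorAlgebra ℂ (Fin 7 → ℂ) →ₗ[ℂ] ℂ :=
  ExteriorAlgebra.liftAlternating (Pi.single 7 (Pi.basisFun ℂ (Fin 7)).det)

theorem vol_ιMulti_ne_zero {n : ℕ} (hn : n = 7) {w : Fin n → Fin 7 → ℂ}
    (hw : LinearIndependent ℂ w) : vol (ExteriorAlgebra.ιMulti ℂ n w) ≠ 0 := by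
  subst hn
  rw [vol, ExteriorAlgebra.liftAlternating_apply_ιMulti, Pi.single_eq_same]
  let b := basisOfLinearIndependentOfCardEqFinrank hw (by simp)
  have hb : (b : Fin 7 → Fin 7 → ℂ) = w := coe_basisOfLinearIndependentOfCardEqFinrank _ _
  rw [← hb]
  exact (Module.Basis.isUnit_det (Pi.basisFun ℂ (Fin 7)) b).ne_zero

/-- A coordinate of a multivector in the basis of wedge products is detected by its product with the
complementary basis multivector. -/
theorem repr_eq_zero_of_vol_eq_zero {p q : ℕ} (hpq : p + q = 7)
    (e : Module.Basis (Fin 7) ℂ (Fin 7 → ℂ)) (θ : ⋀[ℂ]^q (Fin 7 → ℂ))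
    (s : Set.powersetCard (Fin 7) q) (g : Fin p → Fin 7) (hg : Function.Injective g)
    (hgs : ∀ l, g l ∉ (s : Finset (Fin 7)))
    (h : vol (ExteriorAlgebra.ιMulti ℂ p (e ∘ g) * (θ : ExteriorAlgebra ℂ (Fin 7 → ℂ))) = 0) :
    (e.exteriorPower q).repr θ s = 0 := by
  let emb := fun t : Set.powersetCard (Fin 7) q => Set.powersetCard.ofFinEmbEquiv.symm t
  have hθ := (e.exteriorPower q).sum_repr θ
  have happ : ∀ t, ExteriorAlgebra.ιMulti ℂ p (e ∘ g) *
      (e.exteriorPower q t : ExteriorAlgebra ℂ (Fin 7 → ℂ)) =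
      ExteriorAlgebra.ιMulti ℂ (p + q) (e ∘ Fin.append g (emb t)) := by
    intro t
    rw [exteriorPower.basis_apply, exteriorPower.ιMulti_family_apply_coe,
      ExteriorAlgebra.ιMulti_family, ExteriorAlgebra.ιMulti_mul_ιMulti]
    congr 1
    funext l
    induction l using Fin.addCases <;> simp [emb]
  have hmem : ∀ (t : Set.powersetCard (Fin 7) q) l, emb t l ∈ (t : Finset (Fin 7)) := by
    intro t l
    have := (Set.powersetCard.mem_range_ofFinEmbEquiv_symm_iff_mem t (emb t l)).1 ⟨l, rfl⟩
    exact this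
  -- If the indices of `t` avoided those of `g`, they would fill the complement, which is `s`. So
  -- for `t ≠ s` a factor is repeated.
  have hne : ∀ t ≠ s, vol (ExteriorAlgebra.ιMulti ℂ (p + q) (e ∘ Fin.append g (emb t))) = 0 := by
    intro t hts
    rw [ExteriorAlgebra.ιMulti_eq_zero_of_not_inj, map_zero]
    intro hinj
    have hinj' : Function.Injective (Fin.append g (emb t)) := hinj.of_comp
    have hbij : Function.Bijective (Fin.append g (emb t)) := by
      rw [Fintype.bijective_iff_injective_and_card]
      exact ⟨hinj', by simp [hpq]⟩
    apply hts
    have hsub : (s : Finset (Fin 7)) ⊆ (t : Finset (Fin 7)) := by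
      intro x hx
      obtain ⟨l, hl⟩ := hbij.2 x
      induction l using Fin.addCases with
      | left l => rw [Fin.append_left] at hl; exact absurd hx (hl ▸ hgs l)
      | right l => rw [Fin.append_right] at hl; exact hl ▸ hmem t l
    refine Subtype.ext (Finset.eq_of_subset_of_card_le hsub ?_).symm
    rw [Set.powersetCard.mem_iff.1 t.2, Set.powersetCard.mem_iff.1 s.2]
  rw [← hθ, Submodule.coe_sum, Finset.mul_sum, map_sum, Finset.sum_eq_single s] at h
  · rw [Submodule.coe_smul, mul_smul_comm, map_smul, happ, smul_eq_mul] at h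
    refine (mul_eq_zero.1 h).resolve_right (vol_ιMulti_ne_zero hpq ?_)
    refine e.linearIndependent.comp _ (Fin.append_injective_iff.2 ⟨hg, (emb s).injective, ?_⟩)
    intro i j hij
    exact hgs i (hij ▸ hmem s j)
  · intro t _ hts
    rw [Submodule.coe_smul, mul_smul_comm, map_smul, happ, hne t hts, smul_zero]
  · simp

/-- The alternating four-form `(a, b, c, d) ↦ vol (a ∧ b ∧ c ∧ d ∧ ω)`. -/
def quad (ω : ⋀[ℂ]^3 (Fin 7 → ℂ)) (a b c d : Fin 7 → ℂ) : ℂ :=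
  vol (ExteriorAlgebra.ι ℂ a * ExteriorAlgebra.ι ℂ b * (ExteriorAlgebra.ι ℂ c *
    ExteriorAlgebra.ι ℂ d * (ω : ExteriorAlgebra ℂ (Fin 7 → ℂ))))

theorem ι_mul_ι_swap (x y : Fin 7 → ℂ) :
    ExteriorAlgebra.ι ℂ y * ExteriorAlgebra.ι ℂ x =
      -(ExteriorAlgebra.ι ℂ x * ExteriorAlgebra.ι ℂ y) := by
  rw [eq_neg_iff_add_eq_zero, ExteriorAlgebra.ι_add_mul_swap]

section quad

variable (ω : ⋀[ℂ]^3 (Fin 7 → ℂ)) (a a' b b' c c' d d' : Fin 7 → ℂ) (r : ℂ)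

theorem quad_add₁ : quad ω (a + a') b c d = quad ω a b c d + quad ω a' b c d := by
  simp [quad, add_mul]

theorem quad_add₂ : quad ω a (b + b') c d = quad ω a b c d + quad ω a b' c d := by
  simp [quad, add_mul, mul_add]

theorem quad_add₃ : quad ω a b (c + c') d = quad ω a b c d + quad ω a b c' d := by
  simp [quad, add_mul, mul_add]

theorem quad_add₄ : quad ω a b c (d + d') = quad ω a b c d + quad ω a b c d' := by
  simp [quad, add_mul, mul_add]

theorem quad_smul₁ : quad ω (r • a) b c d = r * quad ω a b c d := by
  simp [quad]

theorem quad_smul₂ : quad ω a (r • b) c d = r * quad ω a b c d := by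
  simp [quad]

theorem quad_smul₃ : quad ω a b (r • c) d = r * quad ω a b c d := by
  simp [quad]

theorem quad_smul₄ : quad ω a b c (r • d) = r * quad ω a b c d := by
  simp [quad]

theorem quad_swap₁ : quad ω b a c d = -quad ω a b c d := by
  rw [quad, ι_mul_ι_swap a b, neg_mul, map_neg, quad]

theorem quad_swap₂ : quad ω a c b d = -quad ω a b c d := by
  have : ExteriorAlgebra.ι ℂ a * ExteriorAlgebra.ι ℂ c * (ExteriorAlgebra.ι ℂ b *
      ExteriorAlgebra.ι ℂ d * (ω : ExteriorAlgebra ℂ (Fin 7 → ℂ))) =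
      ExteriorAlgebra.ι ℂ a * (ExteriorAlgebra.ι ℂ c * ExteriorAlgebra.ι ℂ b) *
      (ExteriorAlgebra.ι ℂ d * (ω : ExteriorAlgebra ℂ (Fin 7 → ℂ))) := by
    simp only [mul_assoc]
  rw [quad, this, ι_mul_ι_swap b c, mul_neg, neg_mul, map_neg, quad]
  simp only [mul_assoc]

theorem quad_swap₃ : quad ω a b d c = -quad ω a b c d := by
  rw [quad, ι_mul_ι_swap c d, neg_mul, mul_neg, map_neg, quad]

theorem quad_self₁ : quad ω a a c d = 0 := by
  rw [quad, ExteriorAlgebra.ι_sq_zero, zero_mul, map_zero]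

theorem quad_self₂ : quad ω a b b d = 0 :=
  self_eq_neg.1 (quad_swap₂ ω a b b d)

theorem quad_self₃ : quad ω a b c c = 0 :=
  self_eq_neg.1 (quad_swap₃ ω a b c c)

theorem quad_pair_swap : quad ω c d a b = quad ω a b c d := by
  rw [quad_swap₂, quad_swap₁, quad_swap₃, quad_swap₂]
  ring

theorem quad_rotate : quad ω a d b c = quad ω a b c d := by
  rw [quad_swap₂, quad_swap₃, neg_neg]

theorem quad_self₁₃ : quad ω a b a d = 0 := by
  rw [quad_swap₂, quad_self₁, neg_zero]

theorem quad_self₁₄ : quad ω a b c a = 0 := by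
  rw [quad_swap₃, quad_self₁₃, neg_zero]

theorem quad_self₂₄ : quad ω a b c b = 0 := by
  rw [quad_swap₃, quad_self₂, neg_zero]

end quad

/-- The form alternates in its first three arguments, so they can be sorted while the fourth stays
fixed. -/
theorem quad_eq_zero_of_lt {ι : Type*} [LinearOrder ι] {ω : ⋀[ℂ]^3 (Fin 7 → ℂ)}
    (u : ι → Fin 7 → ℂ) (d : Fin 7 → ℂ)
    (h : ∀ a b c, a < b → b < c → quad ω (u a) (u b) (u c) d = 0) (a b c : ι) :
    quad ω (u a) (u b) (u c) d = 0 := by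
  have key : ∀ a b c, a < b → quad ω (u a) (u b) (u c) d = 0 := by
    intro a b c hab
    rcases lt_trichotomy b c with hbc | rfl | hbc
    · exact h a b c hab hbc
    · exact quad_self₂ _ _ _ _
    · rw [quad_swap₂, neg_eq_zero]
      rcases lt_trichotomy a c with hac | rfl | hac
      · exact h a c b hac hbc
      · exact quad_self₁ _ _ _ _
      · rw [quad_swap₁, h c a b hac hab, neg_zero]
  rcases lt_trichotomy a b with hab | rfl | hab
  · exact key a b c hab
  · exact quad_self₁ _ _ _ _
  · rw [quad_swap₁, key b a c hab, neg_zero]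

/-- A trivector lies in the span of the basis trivectors satisfying a condition if the values of its
four-form on the complementary basis vectors of the other basis trivectors vanish. -/
theorem mem_span_wedge₃ (e : Module.Basis (Fin 7) ℂ (Fin 7 → ℂ)) (ω : ⋀[ℂ]^3 (Fin 7 → ℂ))
    (S : Fin 7 → Fin 7 → Fin 7 → Prop)
    (h : ∀ i j k a b c d : Fin 7, i < j → j < k → a < b → b < c → c < d →
      (∀ x ∈ [a, b, c, d], x ≠ i ∧ x ≠ j ∧ x ≠ k) → ¬ S i j k →
      quad ω (e a) (e b) (e c) (e d) = 0) :
    ω ∈ Submodule.span ℂ {y | ∃ i j k, i < j ∧ j < k ∧ S i j k ∧ y = wedge₃ e i j k} := by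
  rw [← (e.exteriorPower 3).sum_repr ω]
  refine Submodule.sum_mem _ fun s _ => ?_
  let emb := Set.powersetCard.ofFinEmbEquiv.symm s
  have hs : e.exteriorPower 3 s = wedge₃ e (emb 0) (emb 1) (emb 2) := by
    rw [exteriorPower.basis_apply, ← ιMulti_comp_eq_wedge₃ e emb]
    rfl
  have h01 : emb 0 < emb 1 := emb.strictMono (by decide)
  have h12 : emb 1 < emb 2 := emb.strictMono (by decide)
  by_cases hS : S (emb 0) (emb 1) (emb 2)
  · exact Submodule.smul_mem _ _ (Submodule.subset_span ⟨_, _, _, h01, h12, hS, hs⟩)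
  · have hcard : ((s : Finset (Fin 7))ᶜ).card = 4 := by
      rw [Finset.card_compl, Set.powersetCard.mem_iff.1 s.2]; rfl
    let g := ((s : Finset (Fin 7))ᶜ).orderEmbOfFin hcard
    have hg : ∀ l, g l ∉ (s : Finset (Fin 7)) := fun l =>
      Finset.mem_compl.1 (Finset.orderEmbOfFin_mem _ hcard l)
    have hmem : ∀ l, emb l ∈ (s : Finset (Fin 7)) := fun l =>
      (Set.powersetCard.mem_range_ofFinEmbEquiv_symm_iff_mem s (emb l)).1 ⟨l, rfl⟩
    have hne : ∀ l m, g l ≠ emb m := fun l m hlm => hg l (hlm ▸ hmem m)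
    rw [repr_eq_zero_of_vol_eq_zero (p := 4) rfl e ω s g g.injective hg, zero_smul]
    · exact Submodule.zero_mem _
    · have := h _ _ _ (g 0) (g 1) (g 2) (g 3) h01 h12 (g.strictMono (by decide))
        (g.strictMono (by decide)) (g.strictMono (by decide)) (by simp [hne]) hS
      rw [← this, quad]
      simp [ExteriorAlgebra.ιMulti_apply, mul_assoc]
      rfl

/-! ### Normal forms of kernel elements and what they say about the trivector. -/

/-- Every bivector is a sum of products of pairs from a linearly independent family. -/
theorem exists_bivector_eq_sum (η : ⋀[ℂ]^2 (Fin 7 → ℂ)) :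
    ∃ (r : ℕ) (a b : Fin r → Fin 7 → ℂ), LinearIndependent ℂ (Sum.elim a b) ∧
      (η : ExteriorAlgebra ℂ (Fin 7 → ℂ)) =
        ∑ i, ExteriorAlgebra.ι ℂ (a i) * ExteriorAlgebra.ι ℂ (b i) := by
  classical
  have hex : ∃ r, ∃ a b : Fin r → Fin 7 → ℂ, (η : ExteriorAlgebra ℂ (Fin 7 → ℂ)) =
      ∑ i, ExteriorAlgebra.ι ℂ (a i) * ExteriorAlgebra.ι ℂ (b i) := by
    have hη : η ∈ Submodule.span ℂ (Set.range (exteriorPower.ιMulti ℂ 2 (M := Fin 7 → ℂ))) := by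
      rw [exteriorPower.ιMulti_span]; trivial
    induction hη using Submodule.span_induction with
    | mem x hx =>
      obtain ⟨v, rfl⟩ := hx
      exact ⟨1, fun _ => v 0, fun _ => v 1, by simp [ExteriorAlgebra.ιMulti_apply]; rfl⟩
    | zero => exact ⟨0, Fin.elim0, Fin.elim0, by simp⟩
    | add x y _ _ hx hy =>
      obtain ⟨r, a, b, hx⟩ := hx
      obtain ⟨r', a', b', hy⟩ := hy
      exact ⟨r + r', Fin.append a a', Fin.append b b', by
        simp [Fin.sum_univ_add, hx, hy]⟩
    | smul c x _ hx =>
      obtain ⟨r, a, b, hx⟩ := hx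
      exact ⟨r, fun i => c • a i, b, by simp [hx, Finset.smul_sum]⟩
  obtain ⟨a, b, hη⟩ := Nat.find_spec hex
  have hmin : ∀ n < Nat.find hex, ¬ _ := fun n hn => Nat.find_min hex hn
  generalize Nat.find hex = r at a b hη hmin
  refine ⟨r, a, b, ?_, hη⟩
  -- The number of terms is minimal. A relation with `c i ≠ 0` would express `a i` through the other
  -- vectors, and `a i ∧ b i` could be absorbed into the remaining terms.
  have key : ∀ (a b : Fin r → Fin 7 → ℂ), (η : ExteriorAlgebra ℂ (Fin 7 → ℂ)) =
      ∑ i, ExteriorAlgebra.ι ℂ (a i) * ExteriorAlgebra.ι ℂ (b i) →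
      ∀ (c d : Fin r → ℂ), ∑ i, c i • a i + ∑ i, d i • b i = 0 → ∀ i, c i = 0 := by
    intro a b hη c d hcd i
    by_contra hc
    obtain ⟨n, rfl⟩ : ∃ n, r = n + 1 := ⟨r - 1, by have := i.2; omega⟩
    refine hmin n (Nat.lt_succ_self n) ⟨fun j => a (i.succAbove j) +
      ((c i)⁻¹ * d (i.succAbove j)) • b i,
      fun j => b (i.succAbove j) - ((c i)⁻¹ * c (i.succAbove j)) • b i, ?_⟩
    have ha : a i = -∑ j, ((c i)⁻¹ * c (i.succAbove j)) • a (i.succAbove j) -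
        ∑ j, ((c i)⁻¹ * d (i.succAbove j)) • b (i.succAbove j) - ((c i)⁻¹ * d i) • b i := by
      rw [Fin.sum_univ_succAbove _ i, Fin.sum_univ_succAbove _ i] at hcd
      have := congrArg ((c i)⁻¹ • ·) hcd
      simp only [smul_add, smul_smul, smul_zero, Finset.smul_sum, inv_mul_cancel₀ hc,
        one_smul] at this
      rw [eq_sub_iff_add_eq, eq_sub_iff_add_eq, eq_neg_iff_add_eq_zero, ← this]
      abel
    rw [hη, Fin.sum_univ_succAbove _ i]
    have hab : ExteriorAlgebra.ι ℂ (a i) * ExteriorAlgebra.ι ℂ (b i) =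
        ∑ j, (-(((c i)⁻¹ * c (i.succAbove j)) •
          (ExteriorAlgebra.ι ℂ (a (i.succAbove j)) * ExteriorAlgebra.ι ℂ (b i))) -
          ((c i)⁻¹ * d (i.succAbove j)) •
          (ExteriorAlgebra.ι ℂ (b (i.succAbove j)) * ExteriorAlgebra.ι ℂ (b i))) := by
      rw [ha]
      simp [sub_mul, Finset.sum_mul]
    rw [hab, ← Finset.sum_add_distrib]
    refine Finset.sum_congr rfl fun j _ => ?_
    rw [ι_mul_ι_swap (b i) (b (i.succAbove j))]
    simp only [map_add, map_sub, map_smul, add_mul, mul_sub, smul_mul_assoc, mul_smul_comm,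
      ExteriorAlgebra.ι_sq_zero, smul_zero, add_zero, smul_neg]
    abel
  rw [Fintype.linearIndependent_iff]
  intro g hg
  rw [Fintype.sum_sum_type] at hg
  rintro (i | i)
  · exact key a b hη (fun i => g (.inl i)) (fun i => g (.inr i)) hg i
  -- Since a ∧ b = b ∧ (-a), the coefficients of the `b i` are covered by the same argument.
  · refine key b (fun i => -a i) ?_ (fun i => g (.inr i)) (fun i => -g (.inl i)) ?_ i
    · rw [hη]
      refine Finset.sum_congr rfl fun j _ => ?_
      rw [map_neg, mul_neg, ι_mul_ι_swap (a j) (b j), neg_neg]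
    · rw [← hg, add_comm]
      simp

/-- Multiplying η ∧ ω = 0 by x ∧ y turns membership in the kernel into linear equations for the
four-form. -/
theorem sum_quad_eq_zero {ω : ⋀[ℂ]^3 (Fin 7 → ℂ)} {η : ⋀[ℂ]^2 (Fin 7 → ℂ)}
    (h : contraction ω η = 0) {r : ℕ} {a b : Fin r → Fin 7 → ℂ}
    (hη : (η : ExteriorAlgebra ℂ (Fin 7 → ℂ)) =
      ∑ i, ExteriorAlgebra.ι ℂ (a i) * ExteriorAlgebra.ι ℂ (b i)) (x y : Fin 7 → ℂ) :
    ∑ i, quad ω x y (a i) (b i) = 0 := by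
  have h0 : (η : ExteriorAlgebra ℂ (Fin 7 → ℂ)) * (ω : ExteriorAlgebra ℂ (Fin 7 → ℂ)) = 0 :=
    congrArg Subtype.val h
  simp only [quad]
  rw [← map_sum, ← Finset.mul_sum, ← Finset.sum_mul, ← hη, h0, mul_zero, map_zero]

theorem quad_eq_zero_of_contraction {ω : ⋀[ℂ]^3 (Fin 7 → ℂ)} {a b : Fin 7 → ℂ}
    (h : contraction ω (exteriorPower.ιMulti ℂ 2 ![a, b]) = 0) (x y : Fin 7 → ℂ) :
    quad ω x y a b = 0 := by
  simpa using sum_quad_eq_zero h (r := 1) (a := ![a]) (b := ![b])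
    (by simp [ExteriorAlgebra.ιMulti_apply]) x y

/-- The three normal forms of a nonzero bivector of `ℂ⁷`, applied to the elements of the kernel of
the contraction operator. -/
theorem exists_basis_of_mem_ker {ω : ⋀[ℂ]^3 (Fin 7 → ℂ)} {η : ⋀[ℂ]^2 (Fin 7 → ℂ)} (hη : η ≠ 0)
    (h : contraction ω η = 0) :
    (∃ e : Module.Basis (Fin 7) ℂ (Fin 7 → ℂ), η = exteriorPower.ιMulti ℂ 2 ![e 0, e 1] ∧
      ∀ x y, quad ω x y (e 0) (e 1) = 0) ∨
    (∃ e : Module.Basis (Fin 7) ℂ (Fin 7 → ℂ),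
      ∀ x y, quad ω x y (e 0) (e 1) + quad ω x y (e 2) (e 3) = 0) ∨
    ∃ e : Module.Basis (Fin 7) ℂ (Fin 7 → ℂ),
      ∀ x y, quad ω x y (e 0) (e 1) + quad ω x y (e 2) (e 3) + quad ω x y (e 4) (e 5) = 0 := by
  obtain ⟨r, a, b, hli, hab⟩ := exists_bivector_eq_sum η
  have hr : r + r ≤ 7 := by simpa using hli.fintype_card_le_finrank
  have hq := sum_quad_eq_zero h hab
  obtain rfl | rfl | rfl | rfl : r = 0 ∨ r = 1 ∨ r = 2 ∨ r = 3 := by omega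
  · exact absurd (Subtype.ext (by simpa using hab)) hη
  · left
    obtain ⟨_, e, he⟩ := exists_basis_extending
      (hli.comp (![.inl 0, .inr 0] : Fin 2 → Fin 1 ⊕ Fin 1) (by decide))
    have h0 : e 0 = a 0 := he 0
    have h1 : e 1 = b 0 := he 1
    refine ⟨e, Subtype.ext ?_, fun x y => by simpa [h0, h1] using hq x y⟩
    simpa [ExteriorAlgebra.ιMulti_apply, h0, h1] using hab
  · right; left
    obtain ⟨_, e, he⟩ := exists_basis_extending
      (hli.comp (![.inl 0, .inr 0, .inl 1, .inr 1] : Fin 4 → Fin 2 ⊕ Fin 2) (by decide))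
    have h0 : e 0 = a 0 := he 0
    have h1 : e 1 = b 0 := he 1
    have h2 : e 2 = a 1 := he 2
    have h3 : e 3 = b 1 := he 3
    exact ⟨e, fun x y => by simpa [h0, h1, h2, h3, Fin.sum_univ_two] using hq x y⟩
  · right; right
    obtain ⟨_, e, he⟩ := exists_basis_extending
      (hli.comp (![.inl 0, .inr 0, .inl 1, .inr 1, .inl 2, .inr 2] : Fin 6 → Fin 3 ⊕ Fin 3)
        (by decide))
    have h0 : e 0 = a 0 := he 0
    have h1 : e 1 = b 0 := he 1
    have h2 : e 2 = a 1 := he 2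
    have h3 : e 3 = b 1 := he 3
    have h4 : e 4 = a 2 := he 4
    have h5 : e 5 = b 2 := he 5
    exact ⟨e, fun x y => by simpa [h0, h1, h2, h3, h4, h5, Fin.sum_univ_three] using hq x y⟩

/-- A basis trivector without index 0 or 1 has both in its complement, so its coordinate is a value
of the four-form that vanishes by hypothesis. -/
theorem mem_span_of_quad_rank_two {ω : ⋀[ℂ]^3 (Fin 7 → ℂ)}
    (e : Module.Basis (Fin 7) ℂ (Fin 7 → ℂ)) (h : ∀ x y, quad ω x y (e 0) (e 1) = 0) :
    ω ∈ Submodule.span ℂ {y | ∃ i j k, i < j ∧ j < k ∧ i < 2 ∧ y = wedge₃ e i j k} := by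
  refine mem_span_wedge₃ e ω (fun i j k => i < 2) ?_
  intro i j k a b c d hij hjk hab hbc hcd hne hi
  simp only [List.mem_cons, List.not_mem_nil, or_false, forall_eq_or_imp, forall_eq] at hne
  obtain ⟨rfl, rfl⟩ : a = 0 ∧ b = 1 := by omega
  rw [quad_pair_swap]
  exact h _ _

/-- Choosing x among e₀, …, e₃ repeats an argument in one of the two terms, so the other term
vanishes alone. -/
theorem quad_eq_zero_of_rank_four {ω : ⋀[ℂ]^3 (Fin 7 → ℂ)}
    (e : Module.Basis (Fin 7) ℂ (Fin 7 → ℂ))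
    (h : ∀ x y, quad ω x y (e 0) (e 1) + quad ω x y (e 2) (e 3) = 0) (a b c : Fin 7)
    (ha : a < 4) (hb : b < 4) (hc : c < 4) (d : Fin 7 → ℂ) :
    quad ω (e a) (e b) (e c) d = 0 := by
  have key : ∀ a b c : Fin 7, a < b → b < c → c < 4 → quad ω (e a) (e b) (e c) d = 0 := by
    intro a b c hab hbc hc
    obtain ⟨rfl, rfl⟩ | ⟨rfl, rfl, rfl⟩ | ⟨rfl, rfl, rfl⟩ :
        (a = 0 ∧ b = 1) ∨ (a = 0 ∧ b = 2 ∧ c = 3) ∨ (a = 1 ∧ b = 2 ∧ c = 3) := by omega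
    · have := h (e c) d
      obtain rfl | rfl : c = 2 ∨ c = 3 := by omega
      · rwa [quad_self₁₃, add_zero, quad_pair_swap] at this
      · rwa [quad_self₁₄, add_zero, quad_pair_swap] at this
    · have := h (e 0) d
      rwa [quad_self₁₃, zero_add, quad_rotate] at this
    · have := h (e 1) d
      rwa [quad_self₁₄, zero_add, quad_rotate] at this
  exact quad_eq_zero_of_lt (fun i : {i : Fin 7 // i < 4} => e i) d
    (fun a b c hab hbc => key a b c hab hbc c.2) ⟨a, ha⟩ ⟨b, hb⟩ ⟨c, hc⟩

/-- If the middle index is at least 4, the complement contains at least three of the indices 0, 1,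
2, 3. -/
theorem mem_span_of_quad_rank_four {ω : ⋀[ℂ]^3 (Fin 7 → ℂ)}
    (e : Module.Basis (Fin 7) ℂ (Fin 7 → ℂ))
    (h : ∀ x y, quad ω x y (e 0) (e 1) + quad ω x y (e 2) (e 3) = 0) :
    ω ∈ Submodule.span ℂ {y | ∃ i j k, i < j ∧ j < k ∧ j < 4 ∧ y = wedge₃ e i j k} := by
  refine mem_span_wedge₃ e ω (fun i j k => j < 4) ?_
  intro i j k a b c d hij hjk hab hbc hcd hne hi
  simp only [List.mem_cons, List.not_mem_nil, or_false, forall_eq_or_imp, forall_eq] at hne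
  have hc : c < 4 := by omega
  exact quad_eq_zero_of_rank_four e h a b c (hab.trans (hbc.trans hc)) (hbc.trans hc) hc _

theorem mem_span_of_quad_hyperplane {ω : ⋀[ℂ]^3 (Fin 7 → ℂ)}
    (e : Module.Basis (Fin 7) ℂ (Fin 7 → ℂ))
    (h : ∀ a b c d : Fin 7, a < b → b < c → c < d → d < 6 →
      quad ω (e a) (e b) (e c) (e d) = 0) :
    ω ∈ Submodule.span ℂ {y | ∃ i j k, i < j ∧ j < k ∧ k < 6 ∧ y = wedge₃ e i j k} := by
  refine mem_span_wedge₃ e ω (fun i j k => k < 6) ?_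
  intro i j k a b c d hij hjk hab hbc hcd hne hi
  simp only [List.mem_cons, List.not_mem_nil, or_false, forall_eq_or_imp, forall_eq] at hne
  exact h a b c d hab hbc hcd (by omega)

/-- Four of the six indices contain one of the pairs 01, 23, 45. If they contain just one, inserting
the other two indices for x, y kills the remaining terms. For two full pairs, the equations with x,
y a pair say that the three values q(01,23), q(01,45), q(23,45) have pairwise sums zero, so each is
zero. -/
theorem mem_span_of_quad_rank_six {ω : ⋀[ℂ]^3 (Fin 7 → ℂ)}
    (e : Module.Basis (Fin 7) ℂ (Fin 7 → ℂ))
    (h : ∀ x y, quad ω x y (e 0) (e 1) + quad ω x y (e 2) (e 3) + quad ω x y (e 4) (e 5) = 0) :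
    ω ∈ Submodule.span ℂ {y | ∃ i j k, i < j ∧ j < k ∧ k < 6 ∧ y = wedge₃ e i j k} := by
  refine mem_span_of_quad_hyperplane e ?_
  intro a b c d hab hbc hcd hd
  have h01 := h (e 0) (e 1)
  have h23 := h (e 2) (e 3)
  have h45 := h (e 4) (e 5)
  rw [quad_self₁₃, zero_add] at h01
  rw [quad_self₁₃, add_zero, quad_pair_swap] at h23
  rw [quad_self₁₃, add_zero, quad_pair_swap, quad_pair_swap ω (e 2)] at h45
  by_cases ha : a = 0 ∧ b = 1
  · obtain ⟨rfl, rfl⟩ := ha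
    by_cases h2 : c = 2 ∧ d = 3
    · obtain ⟨rfl, rfl⟩ := h2
      linear_combination (h01 + h23 - h45) / 2
    by_cases h4 : c = 4 ∧ d = 5
    · obtain ⟨rfl, rfl⟩ := h4
      linear_combination (h01 - h23 + h45) / 2
    have := h (e c) (e d)
    obtain ⟨rfl | rfl, rfl | rfl⟩ : (c = 2 ∨ c = 3) ∧ (d = 4 ∨ d = 5) := by omega
    all_goals
      simpa only [quad_self₁₃, quad_self₁₄, quad_self₂, quad_self₂₄, add_zero, zero_add,
        quad_pair_swap ω (e 0)] using this
  by_cases hb : b = 2 ∧ c = 3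
  · obtain ⟨rfl, rfl⟩ := hb
    have := h (e a) (e d)
    obtain ⟨rfl | rfl, rfl | rfl⟩ : (a = 0 ∨ a = 1) ∧ (d = 4 ∨ d = 5) := by omega
    all_goals
      simpa only [quad_self₁₃, quad_self₁₄, quad_self₂, quad_self₂₄, add_zero, zero_add,
        quad_rotate] using this
  · obtain ⟨rfl, rfl⟩ : c = 4 ∧ d = 5 := by omega
    by_cases ha : a = 2 ∧ b = 3
    · obtain ⟨rfl, rfl⟩ := ha
      linear_combination (-h01 + h23 + h45) / 2
    have := h (e a) (e b)
    obtain ⟨rfl | rfl, rfl | rfl⟩ : (a = 0 ∨ a = 1) ∧ (b = 2 ∨ b = 3) := by omega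
    all_goals
      simpa only [quad_self₁₃, quad_self₁₄, quad_self₂, quad_self₂₄, add_zero, zero_add]
        using this

/-! ### Shears of bases, and the rank bound on secant varieties. -/

/-- The map N sending e i to w i satisfies N² = 0, so id + N has the inverse id − N. -/
theorem exists_basis_shear {n : ℕ} (e : Module.Basis (Fin n) ℂ (Fin n → ℂ))
    (w : Fin n → Fin n → ℂ) (hw : ∀ i, e.constr ℂ w (w i) = 0) :
    ∃ e' : Module.Basis (Fin n) ℂ (Fin n → ℂ), ∀ i, e' i = e i + w i := by
  let N := e.constr ℂ w
  have hN : N ∘ₗ N = 0 := e.ext fun i => by simpa [N] using hw i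
  have hN' : ∀ x, N (N x) = 0 := fun x => LinearMap.congr_fun hN x
  let ε : (Fin n → ℂ) ≃ₗ[ℂ] (Fin n → ℂ) := LinearEquiv.ofLinearMap (LinearMap.id + N)
    (LinearMap.id - N) (LinearMap.ext fun x => by simp [hN'])
    (LinearMap.ext fun x => by simp [hN'])
  exact ⟨e.map ε, fun i => by simp [ε, N]⟩

theorem coe_contraction (ω : ⋀[ℂ]^3 (Fin 7 → ℂ)) (η : ⋀[ℂ]^2 (Fin 7 → ℂ)) :
    (contraction ω η : ExteriorAlgebra ℂ (Fin 7 → ℂ)) = η * ω := rfl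

theorem span_ιMulti_basis (e : Module.Basis (Fin 7) ℂ (Fin 7 → ℂ)) :
    Submodule.span ℂ {y | ∃ i j, i < j ∧ y = exteriorPower.ιMulti ℂ 2 ![e i, e j]} = ⊤ := by
  rw [eq_top_iff, ← (e.exteriorPower 2).span_eq, Submodule.span_le]
  rintro _ ⟨s, rfl⟩
  let emb := Set.powersetCard.ofFinEmbEquiv.symm s
  refine Submodule.subset_span ⟨emb 0, emb 1, emb.strictMono (by decide), ?_⟩
  rw [exteriorPower.basis_apply]
  change exteriorPower.ιMulti ℂ 2 (e ∘ emb) = _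
  congr 1
  funext l
  fin_cases l <;> rfl

/-- In a basis starting with the three factors, eᵢ ∧ eⱼ with i < j is killed when i < 3; the six
products from e₃, …, e₆ remain. -/
theorem contractionRank_ιMulti_le (v : Fin 3 → Fin 7 → ℂ) :
    contractionRank (exteriorPower.ιMulti ℂ 3 v) ≤ 6 := by
  classical
  by_cases hv : LinearIndependent ℂ v
  swap
  · rw [(exteriorPower.ιMulti ℂ 3).map_linearDependent v hv, contractionRank, map_zero,
      LinearMap.range_zero, finrank_bot]
    exact Nat.zero_le _
  obtain ⟨h, e, he⟩ := exists_basis_extending hv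
  let F : Fin 7 × Fin 7 → ⋀[ℂ]^5 (Fin 7 → ℂ) := fun p =>
    contraction (exteriorPower.ιMulti ℂ 3 v) (exteriorPower.ιMulti ℂ 2 ![e p.1, e p.2])
  let S : Finset (⋀[ℂ]^5 (Fin 7 → ℂ)) :=
    Finset.image F {(3, 4), (3, 5), (3, 6), (4, 5), (4, 6), (5, 6)}
  have hS : S.card ≤ 6 := Finset.card_image_le.trans (by decide)
  have hle : LinearMap.range (contraction (exteriorPower.ιMulti ℂ 3 v)) ≤
      Submodule.span ℂ (S : Set (⋀[ℂ]^5 (Fin 7 → ℂ))) := by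
    rw [LinearMap.range_eq_map, ← span_ιMulti_basis e, Submodule.map_span, Submodule.span_le]
    rintro _ ⟨_, ⟨i, j, hij, rfl⟩, rfl⟩
    by_cases hi : i < 3
    · have : contraction (exteriorPower.ιMulti ℂ 3 v)
          (exteriorPower.ιMulti ℂ 2 ![e i, e j]) = 0 := by
        apply Subtype.ext
        rw [coe_contraction, exteriorPower.ιMulti_apply_coe, exteriorPower.ιMulti_apply_coe,
          ExteriorAlgebra.ιMulti_mul_ιMulti, ExteriorAlgebra.ιMulti_eq_zero_of_not_inj]
        · rfl
        intro hinj
        have h1 := he ⟨i, by omega⟩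
        have h2 : Fin.append ![e i, e j] v (Fin.castAdd 3 0) =
            Fin.append ![e i, e j] v (Fin.natAdd 2 ⟨i, by omega⟩) := by
          rw [Fin.append_left, Fin.append_right, ← h1]
          rfl
        exact absurd (hinj h2) (by simp [Fin.ext_iff]; omega)
      rw [this]
      exact Submodule.zero_mem _
    · refine Submodule.subset_span (Finset.mem_coe.2 (Finset.mem_image.2 ⟨(i, j), ?_, rfl⟩))
      revert i j
      decide
  calc _ ≤ Module.finrank ℂ (Submodule.span ℂ (S : Set (⋀[ℂ]^5 (Fin 7 → ℂ)))) :=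
        Submodule.finrank_mono hle
    _ ≤ S.card := finrank_span_finset_le_card S
    _ ≤ 6 := hS

theorem contractionRank_sum_le {s : ℕ} (v : Fin s → Fin 3 → Fin 7 → ℂ) :
    contractionRank (∑ i, exteriorPower.ιMulti ℂ 3 (v i)) ≤ 6 * s := by
  induction s with
  | zero => simp [contractionRank]
  | succ s ih =>
    rw [Fin.sum_univ_succ]
    have h1 := contractionRank_ιMulti_le (v 0)
    have h2 := ih fun i => v i.succ
    unfold contractionRank at *
    rw [map_add]
    refine (Submodule.finrank_mono (LinearMap.range_add_le _ _)).trans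
      ((Submodule.finrank_add_le_finrank_add_finrank _ _).trans ?_)
    omega

theorem contractionRank_le_of_mem_affineCone {s : ℕ} {ω : ⋀[ℂ]^3 (Fin 7 → ℂ)}
    (h : ω ∈ affineCone (secantVariety s (Gr 2 6))) : contractionRank ω ≤ 6 * s :=
  finrank_range_le_of_mem_affineCone (k := 2) (n := 6) contraction contractionRank_sum_le h

/-! ### Membership criteria, and sufficiency for the third secant variety. -/

theorem mem_affineCone_Gr_iff {ω : ⋀[ℂ]^3 (Fin 7 → ℂ)} :
    ω ∈ affineCone (Gr 2 6) ↔ ∃ v, ω = exteriorPower.ιMulti ℂ 3 v := by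
  constructor
  · intro h
    by_cases h0 : ω = 0
    · exact ⟨0, by rw [h0, (exteriorPower.ιMulti ℂ 3).map_zero]⟩
    · obtain ⟨a, ha⟩ := Projectivization.exists_smul_eq_mk_rep ℂ ω h0
      obtain ⟨v, hv⟩ := exists_rep_eq_ιMulti (h h0) (↑a⁻¹ : ℂ)
      exact ⟨v, by rw [← hv, ← ha]; exact (inv_smul_smul a ω).symm⟩
  · rintro ⟨v, rfl⟩ h0
    exact mk_ιMulti_mem_Gr v h0

/-- With at least one summand the nonvanishing condition is automatic: padding with zeros shows that
otherwise all decomposables vanish, and they span. -/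
theorem mem_affineCone_secantVariety_of_polyEval {s : ℕ} {ω : ⋀[ℂ]^3 (Fin 7 → ℂ)}
    (h : ∀ f : MvPolynomial (Module.Dual ℂ (⋀[ℂ]^3 (Fin 7 → ℂ))) ℂ,
      (∀ v : Fin (s + 1) → Fin 3 → Fin 7 → ℂ,
        polyEval f (∑ i, exteriorPower.ιMulti ℂ 3 (v i)) = 0) → polyEval f ω = 0) :
    ω ∈ affineCone (secantVariety (s + 1) (Gr 2 6)) := by
  refine mem_affineCone_secantVariety (k := 2) (n := 6) h fun hω => ?_
  by_contra! h0
  have h1 : ∀ v, exteriorPower.ιMulti ℂ 3 (M := Fin 7 → ℂ) v = 0 := by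
    intro v
    have := h0 (Fin.cons v fun _ => 0)
    rw [Fin.sum_univ_succ] at this
    simpa [(exteriorPower.ιMulti ℂ 3).map_zero] using this
  apply hω
  have : ω ∈ Submodule.span ℂ (Set.range (exteriorPower.ιMulti ℂ 3 (M := Fin 7 → ℂ))) := by
    rw [exteriorPower.ιMulti_span]; trivial
  rwa [show Set.range (exteriorPower.ιMulti ℂ 3 (M := Fin 7 → ℂ)) = {0} from
    Set.eq_singleton_iff_unique_mem.2 ⟨⟨0, h1 0⟩, by rintro _ ⟨v, rfl⟩; exact h1 v⟩,
    Submodule.span_zero_singleton, Submodule.mem_bot] at this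

theorem mem_secant_two_of_hyperplane {ω : ⋀[ℂ]^3 (Fin 7 → ℂ)}
    (e : Module.Basis (Fin 7) ℂ (Fin 7 → ℂ))
    (hω : ω ∈ Submodule.span ℂ {y | ∃ i j k, i < j ∧ j < k ∧ k < 6 ∧ y = wedge₃ e i j k}) :
    ω ∈ affineCone (secantVariety 2 (Gr 2 6)) :=
  mem_affineCone_secantVariety_of_polyEval fun f hf =>
    polyEval_eq_zero_of_mem_hyperplane e f hf hω

/-- A trivector with a degenerate contraction operator lies in the third secant variety. -/
theorem mem_secant_three_of_contractionRank {ω : ⋀[ℂ]^3 (Fin 7 → ℂ)}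
    (h : contractionRank ω ≤ 18) : ω ∈ affineCone (secantVariety 3 (Gr 2 6)) := by
  refine mem_affineCone_secantVariety_of_polyEval fun f hf => ?_
  -- The source has dimension 21, so rank at most 18 leaves a kernel.
  have hk : LinearMap.ker (contraction ω) ≠ ⊥ := by
    intro h0
    have h1 := LinearMap.finrank_range_add_finrank_ker (contraction ω)
    rw [h0, finrank_bot, exteriorPower.finrank_eq] at h1
    simp [Nat.choose] at h1
    unfold contractionRank at h
    omega
  obtain ⟨η, hη, hη0⟩ := Submodule.exists_mem_ne_zero_of_ne_bot hk
  rcases exists_basis_of_mem_ker hη0 (LinearMap.mem_ker.1 hη) with ⟨e, -, h⟩ | ⟨e, h⟩ | ⟨e, h⟩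
  · exact polyEval_eq_zero_of_mem_twoSpace e f hf (mem_span_of_quad_rank_two e h)
  · exact polyEval_eq_zero_of_mem_fourSpace e f hf (mem_span_of_quad_rank_four e h)
  · refine polyEval_eq_zero_of_mem_hyperplane e f (fun v => ?_) (mem_span_of_quad_rank_six e h)
    -- In a hyperplane two summands suffice; the third is zero.
    have := hf (Fin.cons 0 v)
    rw [Fin.sum_univ_succ] at this
    simpa [(exteriorPower.ιMulti ℂ 3).map_zero] using this

/-! ### Contraction of rank at most six. -/

theorem vol_contraction (ω : ⋀[ℂ]^3 (Fin 7 → ℂ)) (x y a b : Fin 7 → ℂ) :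
    vol (ExteriorAlgebra.ι ℂ x * ExteriorAlgebra.ι ℂ y *
      (contraction ω (exteriorPower.ιMulti ℂ 2 ![a, b]) : ExteriorAlgebra ℂ (Fin 7 → ℂ))) =
    quad ω x y a b := by
  rw [coe_contraction, quad]
  simp [ExteriorAlgebra.ιMulti_apply]

/-- If the contraction operator has rank at most six and the four-form of `ω` does not vanish on
`e₀, e₁, e₂, e₃`, then a product of two vectors orthogonal to the products of these vectors lies in
the kernel of the contraction operator. -/
theorem contraction_eq_zero_of_orthogonal {ω : ⋀[ℂ]^3 (Fin 7 → ℂ)} (hω : contractionRank ω ≤ 6)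
    (u : Fin 4 → Fin 7 → ℂ) (ht : quad ω (u 0) (u 1) (u 2) (u 3) ≠ 0) (a b : Fin 7 → ℂ)
    (h : ∀ i j, i < j → quad ω (u i) (u j) a b = 0) :
    contraction ω (exteriorPower.ιMulti ℂ 2 ![a, b]) = 0 := by
  let p : Fin 6 → Fin 4 × Fin 4 := ![(0, 1), (0, 2), (0, 3), (1, 2), (1, 3), (2, 3)]
  let φ : Fin 6 → ⋀[ℂ]^5 (Fin 7 → ℂ) := fun k =>
    contraction ω (exteriorPower.ιMulti ℂ 2 ![u (p k).1, u (p k).2])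
  let D : Fin 4 → Fin 4 → (⋀[ℂ]^5 (Fin 7 → ℂ)) →ₗ[ℂ] ℂ := fun i j =>
    vol ∘ₗ LinearMap.mulLeft ℂ (ExteriorAlgebra.ι ℂ (u i) * ExteriorAlgebra.ι ℂ (u j)) ∘ₗ
      (⋀[ℂ]^5 (Fin 7 → ℂ)).subtype
  have hD : ∀ i j x y, D i j (contraction ω (exteriorPower.ιMulti ℂ 2 ![x, y])) =
      quad ω (u i) (u j) x y := fun i j x y => vol_contraction ω _ _ x y
  -- The value on two index pairs is ±t for complementary pairs and zero otherwise, so up to sign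
  -- the functionals `D` are dual to the family `φ`.
  have hcoef : ∀ g : Fin 6 → ℂ, (∀ i j, i < j → D i j (∑ k, g k • φ k) = 0) → ∀ k, g k = 0 := by
    intro g hg
    have key : ∀ i j, i < j → ∑ k, g k * quad ω (u i) (u j) (u (p k).1) (u (p k).2) = 0 := by
      intro i j hij
      have := hg i j hij
      simpa [φ, hD, map_sum] using this
    have h01 := key 0 1 (by decide)
    have h02 := key 0 2 (by decide)
    have h03 := key 0 3 (by decide)
    have h12 := key 1 2 (by decide)
    have h13 := key 1 3 (by decide)
    have h23 := key 2 3 (by decide)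
    simp [Fin.sum_univ_succ, p, quad_self₂, quad_self₁₃, quad_self₁₄,
      quad_self₂₄] at h01 h02 h03 h12 h13 h23
    have e1 : quad ω (u 0) (u 2) (u 1) (u 3) ≠ 0 := by rw [quad_swap₂]; simpa using ht
    have e2 : quad ω (u 0) (u 3) (u 1) (u 2) ≠ 0 := by rw [quad_rotate]; simpa using ht
    have e3 : quad ω (u 1) (u 2) (u 0) (u 3) ≠ 0 := by rw [quad_pair_swap]; simpa using e2
    have e4 : quad ω (u 1) (u 3) (u 0) (u 2) ≠ 0 := by rw [quad_pair_swap]; simpa using e1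
    have e5 : quad ω (u 2) (u 3) (u 0) (u 1) ≠ 0 := by rw [quad_pair_swap]; simpa using ht
    simp [ht, e1, e2, e3, e4, e5] at h01 h02 h03 h12 h13 h23
    intro k
    fin_cases k <;> assumption
  have hli : LinearIndependent ℂ φ := by
    rw [Fintype.linearIndependent_iff]
    intro g hg
    exact hcoef g fun i j _ => by rw [hg, map_zero]
  -- Six independent vectors exhaust a range of dimension at most six.
  have hspan : Submodule.span ℂ (Set.range φ) = LinearMap.range (contraction ω) := by
    refine Submodule.eq_of_le_of_finrank_le ?_ ?_
    · rw [Submodule.span_le]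
      rintro _ ⟨k, rfl⟩
      exact ⟨_, rfl⟩
    · rw [finrank_span_eq_card hli]
      simpa [contractionRank] using hω
  have hmem : contraction ω (exteriorPower.ιMulti ℂ 2 ![a, b]) ∈
      Submodule.span ℂ (Set.range φ) := by
    rw [hspan]; exact ⟨_, rfl⟩
  obtain ⟨g, hg⟩ := (Submodule.mem_span_range_iff_exists_fun ℂ).1 hmem
  have hg0 := hcoef g fun i j hij => by rw [hg, hD, h i j hij]
  rw [← hg]
  simp [hg0]

/-- In a sheared basis the four-form vanishes on all increasing basis quadruples except 0123, so
only the coordinate of e₄ ∧ e₅ ∧ e₆ survives. -/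
theorem exists_eq_ιMulti_of_contractionRank {ω : ⋀[ℂ]^3 (Fin 7 → ℂ)}
    (hω : contractionRank ω ≤ 6) : ∃ v, ω = exteriorPower.ιMulti ℂ 3 v := by
  by_cases hz : ∀ a b c d : Fin 7, a < b → b < c → c < d →
      quad ω (Pi.basisFun ℂ (Fin 7) a) (Pi.basisFun ℂ (Fin 7) b) (Pi.basisFun ℂ (Fin 7) c)
        (Pi.basisFun ℂ (Fin 7) d) = 0
  · have := mem_span_wedge₃ (Pi.basisFun ℂ (Fin 7)) ω (fun _ _ _ => False)
      fun i j k a b c d _ _ h1 h2 h3 _ _ => hz a b c d h1 h2 h3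
    simp only [false_and, and_false, exists_false, Set.ofPred_false, Submodule.span_empty,
      Submodule.mem_bot] at this
    exact ⟨0, by rw [this, (exteriorPower.ιMulti ℂ 3).map_zero]⟩
  push Not at hz
  obtain ⟨a, b, c, d, hab, hbc, hcd, ht⟩ := hz
  have hinj : Function.Injective ![a, b, c, d] := by
    have : StrictMono ![a, b, c, d] := by
      rw [Fin.strictMono_iff_lt_succ]
      intro i
      fin_cases i
      exacts [hab, hbc, hcd]
    exact this.injective
  obtain ⟨h47, e, he⟩ := exists_basis_extending
    ((Pi.basisFun ℂ (Fin 7)).linearIndependent.comp _ hinj)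
  have he0 : e 0 = Pi.basisFun ℂ (Fin 7) a := he 0
  have he1 : e 1 = Pi.basisFun ℂ (Fin 7) b := he 1
  have he2 : e 2 = Pi.basisFun ℂ (Fin 7) c := he 2
  have he3 : e 3 = Pi.basisFun ℂ (Fin 7) d := he 3
  rw [← he0, ← he1, ← he2, ← he3] at ht
  let t := quad ω (e 0) (e 1) (e 2) (e 3)
  -- Replacing one of e₀, …, e₃ by e i in `quad ω (e 0) (e 1) (e 2) (e 3)` gives a value which this
  -- correction cancels.
  let w : Fin 7 → Fin 7 → ℂ := fun i => if i < 4 then 0 else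
    (-quad ω (e i) (e 1) (e 2) (e 3) / t) • e 0 + (-quad ω (e 0) (e i) (e 2) (e 3) / t) • e 1 +
    ((-quad ω (e 0) (e 1) (e i) (e 3) / t) • e 2 + (-quad ω (e 0) (e 1) (e 2) (e i) / t) • e 3)
  have hw : ∀ i < 4, w i = 0 := fun i hi => by simp [w, hi]
  obtain ⟨e', he'⟩ := exists_basis_shear e w (by
    intro i
    by_cases hi : i < 4
    · rw [hw i hi, map_zero]
    · have hc : ∀ j < 4, e.constr ℂ w (e j) = 0 := fun j hj => by
        rw [Module.Basis.constr_basis, hw j hj]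
      rw [show w i = _ from if_neg hi]
      simp only [map_add, map_smul, hc 0 (by decide), hc 1 (by decide), hc 2 (by decide),
        hc 3 (by decide), smul_zero, add_zero])
  have hs : ∀ i < 4, e' i = e i := fun i hi => by rw [he', hw i hi, add_zero]
  have hort : ∀ i, ¬ i < 4 → quad ω (e' i) (e 1) (e 2) (e 3) = 0 ∧
      quad ω (e 0) (e' i) (e 2) (e 3) = 0 ∧ quad ω (e 0) (e 1) (e' i) (e 3) = 0 ∧
      quad ω (e 0) (e 1) (e 2) (e' i) = 0 := by
    intro i hi
    have ht' : t ≠ 0 := ht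
    simp only [he', w, if_neg hi, quad_add₁, quad_add₂, quad_add₃, quad_add₄, quad_smul₁,
      quad_smul₂, quad_smul₃, quad_smul₄, quad_self₁, quad_self₂, quad_self₃, quad_self₁₃,
      quad_self₁₄, quad_self₂₄, mul_zero, add_zero, zero_add]
    change _ + _ * t = 0 ∧ _ + _ * t = 0 ∧ _ + _ * t = 0 ∧ _ + _ * t = 0
    simp [div_mul_cancel₀ _ ht']
  -- After the shear, e' i ∧ e j is orthogonal to all six products, hence lies in the kernel.
  have hker : ∀ i, ¬ i < 4 → ∀ j < 4, ∀ x y, quad ω x y (e' i) (e' j) = 0 := by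
    intro i hi j hj
    obtain ⟨h1, h2, h3, h4⟩ := hort i hi
    rw [hs j hj]
    refine quad_eq_zero_of_contraction
      (contraction_eq_zero_of_orthogonal hω ![e 0, e 1, e 2, e 3] ht _ _ ?_)
    intro k l _
    rw [quad_swap₃, neg_eq_zero]
    obtain ⟨m, hm⟩ : ∃ m, ![e 0, e 1, e 2, e 3] m = e j := by
      obtain rfl | rfl | rfl | rfl : j = 0 ∨ j = 1 ∨ j = 2 ∨ j = 3 := by omega
      exacts [⟨0, rfl⟩, ⟨1, rfl⟩, ⟨2, rfl⟩, ⟨3, rfl⟩]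
    rw [← hm]
    refine quad_eq_zero_of_lt (ι := Fin 4) ![e 0, e 1, e 2, e 3] _ ?_ k l m
    intro a b c hab hbc
    obtain ⟨rfl, rfl, rfl⟩ | ⟨rfl, rfl, rfl⟩ | ⟨rfl, rfl, rfl⟩ | ⟨rfl, rfl, rfl⟩ :
      (a = 0 ∧ b = 1 ∧ c = 2) ∨ (a = 0 ∧ b = 1 ∧ c = 3) ∨ (a = 0 ∧ b = 2 ∧ c = 3) ∨
        (a = 1 ∧ b = 2 ∧ c = 3) := by revert a b c; decide
    · exact h4
    · change quad ω (e 0) (e 1) (e 3) (e' i) = 0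
      rw [quad_swap₃, h3, neg_zero]
    · change quad ω (e 0) (e 2) (e 3) (e' i) = 0
      rw [← quad_rotate, h2]
    · change quad ω (e 1) (e 2) (e 3) (e' i) = 0
      rw [← quad_rotate, quad_swap₁, h1, neg_zero]
  have hfin : ω ∈ Submodule.span ℂ
      {y | ∃ i j k, i < j ∧ j < k ∧ (i = 4 ∧ j = 5 ∧ k = 6) ∧ y = wedge₃ e' i j k} := by
    refine mem_span_wedge₃ e' ω (fun i j k => i = 4 ∧ j = 5 ∧ k = 6) ?_
    intro i j k a b c d hij hjk hab hbc hcd hne hi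
    simp only [List.mem_cons, List.not_mem_nil, or_false, forall_eq_or_imp, forall_eq] at hne
    rw [← quad_rotate, ← quad_pair_swap, quad_swap₃, hker d (by omega) a (by omega), neg_zero]
  have hfin' : ω ∈ Submodule.span ℂ {wedge₃ e' 4 5 6} := by
    refine Submodule.span_mono ?_ hfin
    rintro _ ⟨i, j, k, -, -, ⟨rfl, rfl, rfl⟩, rfl⟩
    rfl
  obtain ⟨r, hr⟩ := Submodule.mem_span_singleton.1 hfin'
  refine ⟨![r • e' 4, e' 5, e' 6], ?_⟩
  rw [← hr, wedge₃]
  simpa only [update_vec₃_zero] using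
    ((exteriorPower.ιMulti ℂ 3).map_update_smul ![e' 4, e' 5, e' 6] 0 r (e' 4)).symm

/-! ### Coordinates of bivectors, and spaces of decomposable ones. -/

/-- The coordinates of a bivector, as a skew-symmetric matrix. -/
def bivectorCoord (e : Module.Basis (Fin 7) ℂ (Fin 7 → ℂ)) (i j : Fin 7) :
    (⋀[ℂ]^2 (Fin 7 → ℂ)) →ₗ[ℂ] ℂ :=
  exteriorPower.pairingDual ℂ (Fin 7 → ℂ) 2 (exteriorPower.ιMulti ℂ 2 ![e.coord i, e.coord j])

theorem bivectorCoord_ιMulti (e : Module.Basis (Fin 7) ℂ (Fin 7 → ℂ)) (i j : Fin 7)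
    (a b : Fin 7 → ℂ) : bivectorCoord e i j (exteriorPower.ιMulti ℂ 2 ![a, b]) =
      e.repr a i * e.repr b j - e.repr a j * e.repr b i := by
  rw [bivectorCoord, exteriorPower.pairingDual_ιMulti_ιMulti, Matrix.det_fin_two]
  simp

theorem bivector_linearMap_ext {M : Type*} [AddCommGroup M] [Module ℂ M]
    {f g : (⋀[ℂ]^2 (Fin 7 → ℂ)) →ₗ[ℂ] M}
    (h : ∀ a b, f (exteriorPower.ιMulti ℂ 2 ![a, b]) = g (exteriorPower.ιMulti ℂ 2 ![a, b])) :
    f = g := by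
  refine exteriorPower.linearMap_ext (AlternatingMap.ext fun v => ?_)
  have hv : v = ![v 0, v 1] := by
    funext l
    fin_cases l <;> rfl
  rw [hv]
  exact h _ _

theorem bivectorCoord_swap (e : Module.Basis (Fin 7) ℂ (Fin 7 → ℂ)) (i j : Fin 7)
    (η : ⋀[ℂ]^2 (Fin 7 → ℂ)) : bivectorCoord e j i η = -bivectorCoord e i j η := by
  have : bivectorCoord e j i = -bivectorCoord e i j := bivector_linearMap_ext fun a b => by
    rw [LinearMap.neg_apply, bivectorCoord_ιMulti, bivectorCoord_ιMulti]
    ring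
  rw [this, LinearMap.neg_apply]

theorem bivectorCoord_self (e : Module.Basis (Fin 7) ℂ (Fin 7 → ℂ)) (i : Fin 7)
    (η : ⋀[ℂ]^2 (Fin 7 → ℂ)) : bivectorCoord e i i η = 0 :=
  self_eq_neg.1 (bivectorCoord_swap e i i η)

/-- Summing over all ordered pairs counts each basis bivector twice; this avoids sums over
increasing pairs. -/
theorem two_smul_bivector (e : Module.Basis (Fin 7) ℂ (Fin 7 → ℂ)) (η : ⋀[ℂ]^2 (Fin 7 → ℂ)) :
    (2 : ℂ) • η = ∑ i, ∑ j, bivectorCoord e i j η • exteriorPower.ιMulti ℂ 2 ![e i, e j] := by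
  have : (2 : ℂ) • LinearMap.id = ∑ i, ∑ j, (bivectorCoord e i j).smulRight
      (exteriorPower.ιMulti ℂ 2 ![e i, e j]) := by
    refine bivector_linearMap_ext fun a b => Subtype.ext ?_
    have hab : ∀ a b : Fin 7 → ℂ, ExteriorAlgebra.ι ℂ a * ExteriorAlgebra.ι ℂ b =
        ∑ i, ∑ j, (e.repr a i * e.repr b j) •
          (ExteriorAlgebra.ι ℂ (e i) * ExteriorAlgebra.ι ℂ (e j)) := by
      intro a b
      conv_lhs => rw [← e.sum_repr a, ← e.sum_repr b]
      simp only [map_sum, map_smul, Finset.sum_mul_sum, smul_mul_smul_comm]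
    simp only [LinearMap.smul_apply, LinearMap.id_apply, LinearMap.sum_apply,
      LinearMap.smulRight_apply, bivectorCoord_ιMulti, Submodule.coe_smul, Submodule.coe_sum,
      exteriorPower.ιMulti_apply_coe, ExteriorAlgebra.ιMulti_apply, List.ofFn_succ, List.ofFn_zero,
      List.prod_cons, List.prod_nil, mul_one, Matrix.cons_val_zero, Matrix.cons_val_succ]
    simp only [sub_smul, Finset.sum_sub_distrib]
    rw [← hab]
    have := hab b a
    rw [Finset.sum_congr rfl fun i _ => Finset.sum_congr rfl fun j _ => by
      rw [mul_comm (e.repr b i)]] at this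
    rw [← this, ι_mul_ι_swap a b, sub_neg_eq_add, two_smul]
  simpa using LinearMap.congr_fun this η

theorem bivector_eq_zero (e : Module.Basis (Fin 7) ℂ (Fin 7 → ℂ)) {η : ⋀[ℂ]^2 (Fin 7 → ℂ)}
    (h : ∀ i j, i < j → bivectorCoord e i j η = 0) : η = 0 := by
  have h' : ∀ i j, bivectorCoord e i j η = 0 := by
    intro i j
    rcases lt_trichotomy i j with hij | rfl | hij
    · exact h i j hij
    · exact bivectorCoord_self _ _ _
    · rw [bivectorCoord_swap, h j i hij, neg_zero]
  have := two_smul_bivector e η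
  simpa [h'] using this

theorem sum_bivectorCoord_mul_quad {ω : ⋀[ℂ]^3 (Fin 7 → ℂ)} {η : ⋀[ℂ]^2 (Fin 7 → ℂ)}
    (h : contraction ω η = 0) (e : Module.Basis (Fin 7) ℂ (Fin 7 → ℂ)) (x y : Fin 7 → ℂ) :
    ∑ i, ∑ j, bivectorCoord e i j η * quad ω x y (e i) (e j) = 0 := by
  have h1 : contraction ω ((2 : ℂ) • η) = 0 := by rw [map_smul, h, smul_zero]
  rw [two_smul_bivector e] at h1
  have h2 := congrArg (fun θ : ⋀[ℂ]^5 (Fin 7 → ℂ) =>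
    vol (ExteriorAlgebra.ι ℂ x * ExteriorAlgebra.ι ℂ y * (θ : ExteriorAlgebra ℂ (Fin 7 → ℂ)))) h1
  simpa only [map_sum, map_smul, Submodule.coe_sum, Submodule.coe_smul, Finset.mul_sum,
    mul_smul_comm, vol_contraction, smul_eq_mul, Submodule.coe_zero, mul_zero, map_zero] using h2

theorem exists_mem_ne_zero_of_lt_finrank {M : Type*} [AddCommGroup M] [Module ℂ M]
    [FiniteDimensional ℂ M] (K : Submodule ℂ M) {n : ℕ} (l : Fin n → M →ₗ[ℂ] ℂ)
    (h : n < Module.finrank ℂ K) : ∃ x ∈ K, x ≠ 0 ∧ ∀ i, l i x = 0 := by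
  have : LinearMap.ker (LinearMap.pi l ∘ₗ K.subtype) ≠ ⊥ :=
    LinearMap.ker_ne_bot_of_finrank_lt (by simpa using h)
  obtain ⟨x, hx, hx0⟩ := Submodule.exists_mem_ne_zero_of_ne_bot this
  exact ⟨x, x.2, by simpa using hx0, fun i => congrFun (LinearMap.mem_ker.1 hx) i⟩

/-- A space of bivectors of `ℂ⁷` of dimension at least nine contains an indecomposable one. -/
theorem exists_indecomposable_bivector (K : Submodule ℂ (⋀[ℂ]^2 (Fin 7 → ℂ)))
    (hK : 9 ≤ Module.finrank ℂ K) :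
    ∃ η ∈ K, ∀ a b, η ≠ exteriorPower.ιMulti ℂ 2 ![a, b] := by
  by_contra! hdec
  have hplucker : ∀ (e : Module.Basis (Fin 7) ℂ (Fin 7 → ℂ)), ∀ η ∈ K, ∀ i j k l,
      bivectorCoord e i j η * bivectorCoord e k l η - bivectorCoord e i k η * bivectorCoord e j l η
        + bivectorCoord e i l η * bivectorCoord e j k η = 0 := by
    intro e η hη i j k l
    obtain ⟨a, b, rfl⟩ := hdec η hη
    simp only [bivectorCoord_ιMulti]
    ring
  obtain ⟨η₀, hη₀, hne, -⟩ := exists_mem_ne_zero_of_lt_finrank K (n := 0) Fin.elim0 (by omega)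
  obtain ⟨a, b, rfl⟩ := hdec η₀ hη₀
  have hli : LinearIndependent ℂ ![a, b] := by
    by_contra h
    exact hne ((exteriorPower.ιMulti ℂ 2).map_linearDependent _ h)
  obtain ⟨_, e, he⟩ := exists_basis_extending hli
  obtain rfl : e 0 = a := he 0
  obtain rfl : e 1 = b := he 1
  -- Adding e₀ ∧ e₁ to η raises the 01 coordinate by one and leaves the others in the Plücker
  -- relation 01kl unchanged. The difference of the two relations is the kl coordinate.
  have hkl : ∀ η ∈ K, ∀ k l : Fin 7, 2 ≤ k → 2 ≤ l → bivectorCoord e k l η = 0 := by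
    intro η hη k l hk hl
    have h1 := hplucker e η hη 0 1 k l
    have h2 := hplucker e _ (K.add_mem hη hη₀) 0 1 k l
    have h0k : (0 : Fin 7) ≠ k := by omega
    have h1k : (1 : Fin 7) ≠ k := by omega
    have h0l : (0 : Fin 7) ≠ l := by omega
    have h1l : (1 : Fin 7) ≠ l := by omega
    simp [bivectorCoord_ιMulti, h0k, h1k, h0l, h1l] at h2
    linear_combination h2 - h1
  let P := bivectorCoord e
  -- Eight conditions on a space of dimension at least nine. They give the 2 × 5 matrix of
  -- coordinates p₀ₖ, p₁ₖ, 2 ≤ k ≤ 6, the rows (x, y, z, 0, 0) and (0, x, y, z, 0). Its 2 × 2 minors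
  -- vanish by the Plücker relations, which forces x, y, z to vanish in turn.
  obtain ⟨η, hη, hη0, hl⟩ := exists_mem_ne_zero_of_lt_finrank K
    ![P 0 1, P 0 5, P 0 6, P 1 2, P 1 6, P 1 3 - P 0 2, P 1 4 - P 0 3, P 1 5 - P 0 4] (by omega)
  have p01 : P 0 1 η = 0 := hl 0
  have p05 : P 0 5 η = 0 := hl 1
  have p06 : P 0 6 η = 0 := hl 2
  have p12 : P 1 2 η = 0 := hl 3
  have p16 : P 1 6 η = 0 := hl 4
  have p13 : P 1 3 η = P 0 2 η := sub_eq_zero.1 (hl 5)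
  have p14 : P 1 4 η = P 0 3 η := sub_eq_zero.1 (hl 6)
  have p15 : P 1 5 η = P 0 4 η := sub_eq_zero.1 (hl 7)
  have h23 := hplucker e η hη 0 1 2 3
  have h34 := hplucker e η hη 0 1 3 4
  have h45 := hplucker e η hη 0 1 4 5
  change P 0 1 η * P 2 3 η - P 0 2 η * P 1 3 η + P 0 3 η * P 1 2 η = 0 at h23
  change P 0 1 η * P 3 4 η - P 0 3 η * P 1 4 η + P 0 4 η * P 1 3 η = 0 at h34
  change P 0 1 η * P 4 5 η - P 0 4 η * P 1 5 η + P 0 5 η * P 1 4 η = 0 at h45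
  have p02 : P 0 2 η = 0 := by simpa [p01, p12, p13] using h23
  rw [p02] at p13
  have p03 : P 0 3 η = 0 := by simpa [p01, p13, p14] using h34
  have p04 : P 0 4 η = 0 := by simpa [p01, p05, p15] using h45
  rw [p03] at p14
  rw [p04] at p15
  refine hη0 (bivector_eq_zero e fun i j hij => ?_)
  by_cases hi : 2 ≤ i
  · exact hkl η hη i j hi (by omega)
  obtain rfl | rfl : i = 0 ∨ i = 1 := by omega
  · obtain rfl | rfl | rfl | rfl | rfl | rfl :
      j = 1 ∨ j = 2 ∨ j = 3 ∨ j = 4 ∨ j = 5 ∨ j = 6 := by omega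
    all_goals assumption
  · obtain rfl | rfl | rfl | rfl | rfl : j = 2 ∨ j = 3 ∨ j = 4 ∨ j = 5 ∨ j = 6 := by omega
    all_goals assumption

/-! ### Kernel elements of rank four and the net of two-forms. -/

/-- A nondegenerate quadratic form in five variables does not vanish on a three-dimensional
subspace. -/
theorem exists_anisotropic_combination {X : Fin 3 → Fin 5 → ℂ} (hX : LinearIndependent ℂ X) :
    ∃ s : Fin 3 → ℂ, -(∑ k, s k * X k 0) ^ 2 - (∑ k, s k * X k 1) * (∑ k, s k * X k 2) +
      (∑ k, s k * X k 3) * (∑ k, s k * X k 4) ≠ 0 := by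
  by_contra! h
  -- The Gram matrix of the polar form, with inverse `J'`.
  let J : Matrix (Fin 5) (Fin 5) ℂ :=
    !![-2, 0, 0, 0, 0; 0, 0, -1, 0, 0; 0, -1, 0, 0, 0; 0, 0, 0, 0, 1; 0, 0, 0, 1, 0]
  let J' : Matrix (Fin 5) (Fin 5) ℂ :=
    !![-1 / 2, 0, 0, 0, 0; 0, 0, -1, 0, 0; 0, -1, 0, 0, 0; 0, 0, 0, 0, 1; 0, 0, 0, 1, 0]
  have hJ : J' * J = 1 := by
    ext i j
    fin_cases i <;> fin_cases j <;> simp [J, J', Matrix.mul_apply, Fin.sum_univ_five]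
  let A : Matrix (Fin 3) (Fin 5) ℂ := Matrix.of X
  -- Polarization. Both factors have rank 3, while a zero product through a five-dimensional space
  -- bounds the sum of ranks by 5.
  have hz : A * (J * A.transpose) = 0 := by
    ext k l
    have h1 := h (Pi.single k 1 + Pi.single l 1)
    have h2 := h (Pi.single k 1)
    have h3 := h (Pi.single l 1)
    simp only [Pi.add_apply, add_mul, Finset.sum_add_distrib, Pi.single_apply, ite_mul, one_mul,
      zero_mul, Finset.sum_ite_eq', Finset.mem_univ, if_true] at h1 h2 h3
    simp only [Matrix.mul_apply]
    simp [A, J, Fin.sum_univ_five]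
    linear_combination h1 - h2 - h3
  have h1 := Matrix.rank_add_rank_le_card_of_mul_eq_zero hz
  have hA : A.rank = 3 := by simpa using LinearIndependent.rank_matrix (M := A) hX
  rw [Matrix.rank_mul_eq_right_of_isUnit_det _ _ (Matrix.isUnit_det_of_left_inverse hJ),
    Matrix.rank_transpose, hA] at h1
  simp at h1

/-- A skew-symmetric matrix of size four with nonzero Pfaffian is injective. -/
theorem eq_zero_of_pfaffian_ne_zero {C : Fin 4 → Fin 4 → ℂ} (hC : ∀ i j, C j i = -C i j)
    (hpf : C 0 1 * C 2 3 - C 0 2 * C 1 3 + C 0 3 * C 1 2 ≠ 0) {p : Fin 4 → ℂ}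
    (h : ∀ a, ∑ w, C a w * p w = 0) (w : Fin 4) : p w = 0 := by
  have h0 := h 0
  have h1 := h 1
  have h2 := h 2
  have h3 := h 3
  have hs : ∀ i, C i i = 0 := fun i => self_eq_neg.1 (hC i i)
  rw [Fin.sum_univ_four] at h0 h1 h2 h3
  rw [hs, zero_mul] at h0 h1 h2 h3
  rw [hC 0 1] at h1
  rw [hC 0 2, hC 1 2] at h2
  rw [hC 0 3, hC 1 3, hC 2 3] at h3
  apply (mul_eq_zero.1 (_ : (C 0 1 * C 2 3 - C 0 2 * C 1 3 + C 0 3 * C 1 2) * p w = 0)).resolve_left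
    hpf
  obtain rfl | rfl | rfl | rfl : w = 0 ∨ w = 1 ∨ w = 2 ∨ w = 3 := by omega
  -- The coefficients are the rows of the Pfaffian adjugate, whose product with `C` is the Pfaffian
  -- times the identity.
  · linear_combination -C 2 3 * h1 + C 1 3 * h2 - C 1 2 * h3
  · linear_combination C 2 3 * h0 - C 0 3 * h2 + C 0 2 * h3
  · linear_combination -C 1 3 * h0 + C 0 3 * h1 - C 0 1 * h3
  · linear_combination C 1 2 * h0 - C 0 2 * h1 + C 0 1 * h2

/-- A change of the last three vectors of a basis which turns a given bivector in them, up to a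
scalar, into the product of the first two. -/
theorem exists_basis_change (ω : ⋀[ℂ]^3 (Fin 7 → ℂ)) (e : Module.Basis (Fin 7) ℂ (Fin 7 → ℂ))
    (s : Fin 3 → ℂ) (hs : s ≠ 0) :
    ∃ e' : Module.Basis (Fin 7) ℂ (Fin 7 → ℂ), (∀ i < 4, e' i = e i) ∧ ∃ c : ℂ, c ≠ 0 ∧
      ∀ x y, quad ω x y (e' 4) (e' 5) = c * (s 0 * quad ω x y (e 5) (e 6) +
        s 1 * quad ω x y (e 6) (e 4) + s 2 * quad ω x y (e 4) (e 5)) := by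
  have key : ∀ (e : Module.Basis (Fin 7) ℂ (Fin 7 → ℂ)) (s : Fin 3 → ℂ), s 2 ≠ 0 →
      ∃ e' : Module.Basis (Fin 7) ℂ (Fin 7 → ℂ), (∀ i < 4, e' i = e i) ∧ ∃ c : ℂ, c ≠ 0 ∧
        ∀ x y, quad ω x y (e' 4) (e' 5) = c * (s 0 * quad ω x y (e 5) (e 6) +
          s 1 * quad ω x y (e 6) (e 4) + s 2 * quad ω x y (e 4) (e 5)) := by
    intro e s h2
    -- (e₄ − (s₀/s₂) e₆) ∧ (e₅ − (s₁/s₂) e₆) is s₂⁻¹ times the bivector s₀ e₅ ∧ e₆ + s₁ e₆ ∧ e₄ + s₂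
    -- e₄ ∧ e₅.
    let w : Fin 7 → Fin 7 → ℂ :=
      ![0, 0, 0, 0, (-(s 0 / s 2)) • e 6, (-(s 1 / s 2)) • e 6, 0]
    have h6 : e.constr ℂ w (e 6) = 0 := by rw [Module.Basis.constr_basis]; rfl
    obtain ⟨e', he'⟩ := exists_basis_shear e w (by
      intro i
      by_cases h4 : i = 4
      · subst h4
        change e.constr ℂ w ((-(s 0 / s 2)) • e 6) = 0
        rw [map_smul, h6, smul_zero]
      by_cases h5 : i = 5
      · subst h5
        change e.constr ℂ w ((-(s 1 / s 2)) • e 6) = 0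
        rw [map_smul, h6, smul_zero]
      obtain rfl | rfl | rfl | rfl | rfl : i = 0 ∨ i = 1 ∨ i = 2 ∨ i = 3 ∨ i = 6 := by omega
      all_goals exact map_zero _)
    refine ⟨e', fun i hi => ?_, (s 2)⁻¹, inv_ne_zero h2, fun x y => ?_⟩
    · obtain rfl | rfl | rfl | rfl : i = 0 ∨ i = 1 ∨ i = 2 ∨ i = 3 := by omega
      all_goals rw [he']; simp [w]
    · have h4 : e' 4 = e 4 + (-(s 0 / s 2)) • e 6 := he' 4
      have h5 : e' 5 = e 5 + (-(s 1 / s 2)) • e 6 := he' 5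
      rw [h4, h5, quad_add₃, quad_add₄, quad_add₄, quad_smul₃, quad_smul₄, quad_smul₃, quad_smul₄,
        quad_self₃, quad_swap₃ ω x y (e 5) (e 6), quad_swap₃ ω x y (e 6) (e 4)]
      field_simp
      ring
  have hperm : ∀ f : Fin 7 → Fin 7, Function.Injective f →
      ∃ e' : Module.Basis (Fin 7) ℂ (Fin 7 → ℂ), ∀ i, e' i = e (f i) := by
    intro f hf
    obtain ⟨_, e', he'⟩ := exists_basis_extending (e.linearIndependent.comp f hf)
    exact ⟨e', he'⟩
  -- A cyclic permutation of e₄, e₅, e₆ moves a nonzero coefficient into the last place.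
  by_cases h2 : s 2 = 0
  swap
  · exact key e s h2
  by_cases h1 : s 1 = 0
  · have h0 : s 0 ≠ 0 := by
      intro h0
      apply hs
      funext k
      fin_cases k <;> assumption
    obtain ⟨e₁, he₁⟩ := hperm ![0, 1, 2, 3, 5, 6, 4] (by decide)
    have h4 : e₁ 4 = e 5 := he₁ 4
    have h5 : e₁ 5 = e 6 := he₁ 5
    have h6 : e₁ 6 = e 4 := he₁ 6
    obtain ⟨e', he', c, hc, h⟩ := key e₁ ![s 1, s 2, s 0] h0
    refine ⟨e', fun i hi => ?_, c, hc, fun x y => ?_⟩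
    · rw [he' i hi, he₁]
      obtain rfl | rfl | rfl | rfl : i = 0 ∨ i = 1 ∨ i = 2 ∨ i = 3 := by omega
      all_goals rfl
    · rw [h, h4, h5, h6]
      simp
      left
      ring
  · obtain ⟨e₁, he₁⟩ := hperm ![0, 1, 2, 3, 6, 4, 5] (by decide)
    have h4 : e₁ 4 = e 6 := he₁ 4
    have h5 : e₁ 5 = e 4 := he₁ 5
    have h6 : e₁ 6 = e 5 := he₁ 6
    obtain ⟨e', he', c, hc, h⟩ := key e₁ ![s 2, s 0, s 1] h1
    refine ⟨e', fun i hi => ?_, c, hc, fun x y => ?_⟩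
    · rw [he' i hi, he₁]
      obtain rfl | rfl | rfl | rfl : i = 0 ∨ i = 1 ∨ i = 2 ∨ i = 3 := by omega
      all_goals rfl
    · rw [h, h4, h5, h6]
      simp
      left
      ring

/-- After the basis change the relation says that the form of e'₄ ∧ e'₅ vanishes on W. Four indices
below 6 either contain three below 4 or are a, b, 4, 5, so the four-form vanishes on a hyperplane.
-/
theorem mem_secant_two_of_dependent {ω : ⋀[ℂ]^3 (Fin 7 → ℂ)}
    (e : Module.Basis (Fin 7) ℂ (Fin 7 → ℂ))
    (hW : ∀ a b c : Fin 7, a < 4 → b < 4 → c < 4 → ∀ d, quad ω (e a) (e b) (e c) d = 0)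
    (s : Fin 3 → ℂ) (hs : s ≠ 0)
    (h : ∀ a b : Fin 7, a < 4 → b < 4 → s 0 * quad ω (e a) (e b) (e 5) (e 6) +
      s 1 * quad ω (e a) (e b) (e 6) (e 4) + s 2 * quad ω (e a) (e b) (e 4) (e 5) = 0) :
    ω ∈ affineCone (secantVariety 2 (Gr 2 6)) := by
  obtain ⟨e', he', c, -, hc⟩ := exists_basis_change ω e s hs
  refine mem_secant_two_of_hyperplane e' (mem_span_of_quad_hyperplane e' ?_)
  intro a b c d hab hbc hcd hd
  have hb : b < 4 := by omega
  rw [he' a (by omega), he' b hb]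
  by_cases hc4 : c < 4
  · rw [he' c hc4]
    exact hW a b c (by omega) hb hc4 _
  · obtain ⟨rfl, rfl⟩ : c = 4 ∧ d = 5 := by omega
    rw [hc, h a b (by omega) hb, mul_zero]

/-- The index pairs of the coordinates of a skew-symmetric matrix of size four. -/
def fourPairs : Fin 6 → Fin 7 × Fin 7 := ![(0, 1), (0, 2), (0, 3), (1, 2), (1, 3), (2, 3)]

theorem skew_eq_zero {F : Fin 7 → Fin 7 → ℂ} (hF : ∀ a b, F b a = -F a b)
    (h : ∀ l, F (fourPairs l).1 (fourPairs l).2 = 0) (a b : Fin 7) (ha : a < 4) (hb : b < 4) :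
    F a b = 0 := by
  have key : ∀ a b : Fin 7, a < b → b < 4 → F a b = 0 := by
    intro a b hab hb
    obtain ⟨rfl, rfl⟩ | ⟨rfl, rfl⟩ | ⟨rfl, rfl⟩ | ⟨rfl, rfl⟩ | ⟨rfl, rfl⟩ | ⟨rfl, rfl⟩ :
      (a = 0 ∧ b = 1) ∨ (a = 0 ∧ b = 2) ∨ (a = 0 ∧ b = 3) ∨ (a = 1 ∧ b = 2) ∨ (a = 1 ∧ b = 3) ∨
        (a = 2 ∧ b = 3) := by omega
    exacts [h 0, h 1, h 2, h 3, h 4, h 5]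
  rcases lt_trichotomy a b with hab | rfl | hab
  · exact key a b hab hb
  · exact self_eq_neg.1 (hF a a)
  · rw [hF, key b a hab ha, neg_zero]

/-- The three two-forms `quad ω · · u u'`, for two of the last three basis vectors `u, u'`. -/
def netForm (ω : ⋀[ℂ]^3 (Fin 7 → ℂ)) (e : Module.Basis (Fin 7) ℂ (Fin 7 → ℂ)) (k : Fin 3)
    (a b : Fin 7) : ℂ :=
  quad ω (e a) (e b) (e (![5, 6, 4] k)) (e (![6, 4, 5] k))

theorem netForm_swap (ω : ⋀[ℂ]^3 (Fin 7 → ℂ)) (e : Module.Basis (Fin 7) ℂ (Fin 7 → ℂ)) (k : Fin 3)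
    (a b : Fin 7) : netForm ω e k b a = -netForm ω e k a b :=
  quad_swap₁ _ _ _ _ _

/-- If the three two-forms are linearly independent and the last one is nondegenerate, the kernel
of the contraction operator has dimension at most seven. -/
theorem finrank_ker_le_seven {ω : ⋀[ℂ]^3 (Fin 7 → ℂ)}
    (e : Module.Basis (Fin 7) ℂ (Fin 7 → ℂ))
    (hW : ∀ a b c : Fin 7, a < 4 → b < 4 → c < 4 → ∀ d, quad ω (e a) (e b) (e c) d = 0)
    (hind : ∀ s : Fin 3 → ℂ, (∀ a b : Fin 7, a < 4 → b < 4 → ∑ k, s k * netForm ω e k a b = 0) →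
      s = 0)
    (hpf : netForm ω e 2 0 1 * netForm ω e 2 2 3 - netForm ω e 2 0 2 * netForm ω e 2 1 3 +
      netForm ω e 2 0 3 * netForm ω e 2 1 2 ≠ 0) :
    Module.finrank ℂ (LinearMap.ker (contraction ω)) ≤ 7 := by
  by_contra! hK
  let P := bivectorCoord e
  let M : Fin 3 → Fin 6 → ℂ := fun k l => netForm ω e k (fourPairs l).1 (fourPairs l).2
  have hM : LinearIndependent ℂ M := by
    rw [Fintype.linearIndependent_iff]
    intro s hs
    refine congrFun (hind s (skew_eq_zero (fun a b => ?_) fun l => ?_))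
    · simp_rw [netForm_swap ω e _ a b, mul_neg, Finset.sum_neg_distrib]
    · simpa [M] using congrFun hs l
  -- The three forms are completed by r₃, r₄, r₅ to a basis of the six-dimensional coordinate space.
  obtain ⟨_, r, hr⟩ := exists_basis_extending hM
  let lin : (Fin 6 → ℂ) → (⋀[ℂ]^2 (Fin 7 → ℂ)) →ₗ[ℂ] ℂ := fun v =>
    ∑ l, v l • P (fourPairs l).1 (fourPairs l).2
  -- Seven conditions leave a nonzero η in a kernel of dimension at least eight: four kill the
  -- coordinates i6 with i < 4, three complement the equations imposed by the net. All coordinates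
  -- of η will turn out to be zero.
  obtain ⟨η, hη, hη0, hl⟩ := exists_mem_ne_zero_of_lt_finrank _
    ![P 0 6, P 1 6, P 2 6, P 3 6, lin (r 3), lin (r 4), lin (r 5)] hK
  have hp6 : ∀ i < 4, P i 6 η = 0 := by
    intro i hi
    obtain rfl | rfl | rfl | rfl : i = 0 ∨ i = 1 ∨ i = 2 ∨ i = 3 := by omega
    exacts [hl 0, hl 1, hl 2, hl 3]
  have heq : ∀ x y, ∑ i, ∑ j, P i j η * quad ω x y (e i) (e j) = 0 :=
    sum_bivectorCoord_mul_quad (LinearMap.mem_ker.1 hη) e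
  have hsw : ∀ i j, P j i η = -P i j η := fun i j => bivectorCoord_swap e i j η
  have hse : ∀ i, P i i η = 0 := fun i => bivectorCoord_self e i η
  have hW2 : ∀ a b c : Fin 7, a < 4 → b < 4 → c < 4 → ∀ d, quad ω (e a) (e b) d (e c) = 0 :=
    fun a b c ha hb hc d => by rw [quad_swap₃, hW a b c ha hb hc, neg_zero]
  have hW3 : ∀ a b c : Fin 7, a < 4 → b < 4 → c < 4 → ∀ d, quad ω (e a) d (e b) (e c) = 0 :=
    fun a b c ha hb hc d => by rw [quad_swap₂, hW2 a b c ha hb hc, neg_zero]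
  -- Paired with e a ∧ e b for a, b < 4, only the coordinates 56, 64, 45 survive; they are the
  -- coefficients of a relation in the net. Ordered pairs count twice, hence the division by 2.
  have hnet : ∀ k, (![P 5 6 η, P 6 4 η, P 4 5 η] : Fin 3 → ℂ) k = 0 := by
    refine congrFun (hind _ fun a b ha hb => ?_)
    have h := heq (e a) (e b)
    simp only [Fin.sum_univ_seven, hW a b _ ha hb, hW2 a b _ ha hb, quad_self₃, Fin.reduceLT,
      mul_zero, add_zero, zero_add] at h
    rw [hsw 4 5, hsw 6 4, hsw 5 6, quad_swap₃ ω _ _ (e 4) (e 5), quad_swap₃ ω _ _ (e 5) (e 6),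
      quad_swap₃ ω _ _ (e 6) (e 4)] at h
    simp only [Fin.sum_univ_three, netForm, Matrix.cons_val]
    linear_combination h / 2
  have p56 : P 5 6 η = 0 := hnet 0
  have p46 : P 4 6 η = 0 := by rw [hsw 6 4, show P 6 4 η = 0 from hnet 1, neg_zero]
  have p45 : P 4 5 η = 0 := hnet 2
  have hcol : ∀ p : Fin 4 → ℂ,
      (∀ a : Fin 4, ∑ w : Fin 4,
        netForm ω e 2 (a.castLE (by omega)) (w.castLE (by omega)) * p w = 0) → ∀ w, p w = 0 := fun p hp =>
    eq_zero_of_pfaffian_ne_zero (C := fun i j => netForm ω e 2 (i.castLE (by omega))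
      (j.castLE (by omega))) (fun i j => netForm_swap _ _ _ _ _) hpf hp
  -- Pairing with e a ∧ e₄ applies the nondegenerate last form to the column of coordinates w5;
  -- below, e a ∧ e₅ does so for w4.
  have hp5 : ∀ w : Fin 4, P (w.castLE (by omega)) 5 η = 0 := by
    refine hcol _ fun a => ?_
    have ha : a.castLE (by omega : 4 ≤ 7) < 4 := a.2
    generalize a.castLE (by omega : 4 ≤ 7) = a at ha
    have h := heq (e a) (e 4)
    simp only [Fin.sum_univ_seven, hW3 a _ _ ha, quad_self₂, quad_self₂₄, quad_self₃, Fin.reduceLT,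
      hp6, hsw 0 6, hsw 1 6, hsw 2 6, hsw 3 6, hsw 5 6, p56, hsw 0 5, hsw 1 5, hsw 2 5, hsw 3 5,
      neg_zero, zero_mul, mul_zero, add_zero, zero_add] at h
    simp only [fun w => quad_swap₃ ω (e a) (e 4) w (e 5),
      fun w => quad_swap₂ ω (e a) w (e 4) (e 5)] at h
    rw [Fin.sum_univ_four]
    change quad ω (e a) (e 0) (e 4) (e 5) * P 0 5 η + quad ω (e a) (e 1) (e 4) (e 5) * P 1 5 η +
      quad ω (e a) (e 2) (e 4) (e 5) * P 2 5 η + quad ω (e a) (e 3) (e 4) (e 5) * P 3 5 η = 0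
    linear_combination -h / 2
  have hp4 : ∀ w : Fin 4, P (w.castLE (by omega)) 4 η = 0 := by
    refine hcol _ fun a => ?_
    have ha : a.castLE (by omega : 4 ≤ 7) < 4 := a.2
    generalize a.castLE (by omega : 4 ≤ 7) = a at ha
    have h := heq (e a) (e 5)
    simp only [Fin.sum_univ_seven, hW3 a _ _ ha, quad_self₂, quad_self₂₄, quad_self₃, Fin.reduceLT,
      hp6, hsw 0 6, hsw 1 6, hsw 2 6, hsw 3 6, hsw 4 6, p46, hsw 0 4, hsw 1 4, hsw 2 4, hsw 3 4,
      neg_zero, zero_mul, mul_zero, add_zero, zero_add] at h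
    simp only [fun w => quad_swap₃ ω (e a) (e 5) w (e 4),
      fun w => quad_swap₂ ω (e a) w (e 5) (e 4), fun w => quad_swap₃ ω (e a) w (e 4) (e 5)] at h
    rw [Fin.sum_univ_four]
    change quad ω (e a) (e 0) (e 4) (e 5) * P 0 4 η + quad ω (e a) (e 1) (e 4) (e 5) * P 1 4 η +
      quad ω (e a) (e 2) (e 4) (e 5) * P 2 4 η + quad ω (e a) (e 3) (e 4) (e 5) * P 3 4 η = 0
    linear_combination h / 2
  have hlast : ∀ i j : Fin 7, i < j → 4 ≤ j → P i j η = 0 := by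
    intro i j hij hj
    obtain rfl | rfl | rfl : j = 4 ∨ j = 5 ∨ j = 6 := by omega
    · exact hp4 ⟨i, by omega⟩
    · by_cases hi : i < 4
      · exact hp5 ⟨i, by omega⟩
      · obtain rfl : i = 4 := by omega
        exact p45
    · by_cases hi : i < 4
      · exact hp6 i hi
      · obtain rfl | rfl : i = 4 ∨ i = 5 := by omega
        exacts [p46, p56]
  have hlast' : ∀ i j : Fin 7, j < i → 4 ≤ i → P i j η = 0 := fun i j hij hi => by
    rw [hsw, hlast j i hij hi, neg_zero]
  -- What remains of η lies in ⋀²W and is annihilated by the three forms of the net.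
  have hfour : ∀ k, ∑ l, M k l * P (fourPairs l).1 (fourPairs l).2 η = 0 := by
    intro k
    have h : ∑ i, ∑ j, P i j η * netForm ω e k i j = 0 := by
      simpa only [netForm, quad_pair_swap] using heq (e (![5, 6, 4] k)) (e (![6, 4, 5] k))
    simp only [Fin.sum_univ_seven, hlast, hlast', hse, Fin.reduceLT, Fin.reduceLE, hsw 0 1, hsw 0 2,
      hsw 0 3, hsw 1 2, hsw 1 3, hsw 2 3, zero_mul, add_zero, zero_add, netForm_swap ω e k 0 1,
      netForm_swap ω e k 0 2, netForm_swap ω e k 0 3,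
      netForm_swap ω e k 1 2, netForm_swap ω e k 1 3, netForm_swap ω e k 2 3] at h
    simp only [M, fourPairs, Fin.sum_univ_six, Matrix.cons_val]
    linear_combination h / 2
  have hlin : ∀ v, lin v η = ∑ l, v l * P (fourPairs l).1 (fourPairs l).2 η := fun v => by
    simp [lin]
  have hr0 : ∀ v : Fin 6 → ℂ, ∑ l, v l * P (fourPairs l).1 (fourPairs l).2 η = 0 := by
    let L : (Fin 6 → ℂ) →ₗ[ℂ] ℂ :=
      ∑ l, P (fourPairs l).1 (fourPairs l).2 η • LinearMap.proj l
    have hL : ∀ v, L v = ∑ l, v l * P (fourPairs l).1 (fourPairs l).2 η := fun v => by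
      simp [L, mul_comm]
    have hL0 : L = 0 := r.ext fun i => by
      rw [hL, LinearMap.zero_apply]
      by_cases hi : i < 3
      · rw [← hfour ⟨i, hi⟩, ← hr]
        rfl
      · rw [← hlin]
        obtain rfl | rfl | rfl : i = 3 ∨ i = 4 ∨ i = 5 := by omega
        exacts [hl 4, hl 5, hl 6]
    intro v
    rw [← hL, hL0, LinearMap.zero_apply]
  refine hη0 (bivector_eq_zero e fun i j hij => ?_)
  by_cases hj : 4 ≤ j
  · exact hlast i j hij hj
  · refine skew_eq_zero (F := fun i j => P i j η) hsw (fun l => ?_) i j (by omega) (by omega)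
    simpa [Pi.single_apply] using hr0 (Pi.single l 1)

/-- If the kernel of the contraction operator has dimension at least eight and contains a bivector
of rank four, the trivector lies in the second secant variety. -/
theorem mem_secant_two_of_rank_four {ω : ⋀[ℂ]^3 (Fin 7 → ℂ)}
    (hK : 8 ≤ Module.finrank ℂ (LinearMap.ker (contraction ω)))
    (e : Module.Basis (Fin 7) ℂ (Fin 7 → ℂ))
    (h : ∀ x y, quad ω x y (e 0) (e 1) + quad ω x y (e 2) (e 3) = 0) :
    ω ∈ affineCone (secantVariety 2 (Gr 2 6)) := by
  by_contra hσ
  have hW := fun a b c ha hb hc d => quad_eq_zero_of_rank_four e h a b c ha hb hc d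
  -- Outside the secant variety, the net is independent for every basis with the same first four
  -- vectors.
  have hind : ∀ e' : Module.Basis (Fin 7) ℂ (Fin 7 → ℂ), (∀ i < 4, e' i = e i) →
      (∀ a b c : Fin 7, a < 4 → b < 4 → c < 4 → ∀ d, quad ω (e' a) (e' b) (e' c) d = 0) ∧
      ∀ s : Fin 3 → ℂ, (∀ a b : Fin 7, a < 4 → b < 4 → ∑ k, s k * netForm ω e' k a b = 0) →
        s = 0 := by
    intro e' he'
    have hW' : ∀ a b c : Fin 7, a < 4 → b < 4 → c < 4 → ∀ d,
        quad ω (e' a) (e' b) (e' c) d = 0 := fun a b c ha hb hc d => by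
      rw [he' a ha, he' b hb, he' c hc, hW a b c ha hb hc]
    refine ⟨hW', fun s hs => ?_⟩
    by_contra hs0
    refine hσ (mem_secant_two_of_dependent e' hW' s hs0 fun a b ha hb => ?_)
    have := hs a b ha hb
    rwa [Fin.sum_univ_three] at this
  have h23 : ∀ k, netForm ω e k 2 3 = -netForm ω e k 0 1 := fun k => by
    have := h (e (![5, 6, 4] k)) (e (![6, 4, 5] k))
    rw [quad_pair_swap, quad_pair_swap ω (e 2)] at this
    exact eq_neg_of_add_eq_zero_right this
  -- As the 23 entry is minus the 01 entry, five coordinates suffice, and in them the Pfaffian is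
  -- −x₀² − x₁x₂ + x₃x₄.
  let X : Fin 3 → Fin 5 → ℂ := fun k =>
    ![netForm ω e k 0 1, netForm ω e k 0 2, netForm ω e k 1 3, netForm ω e k 0 3,
      netForm ω e k 1 2]
  have hX : LinearIndependent ℂ X := by
    rw [Fintype.linearIndependent_iff]
    intro s hs
    refine congrFun ((hind e fun _ _ => rfl).2 s (skew_eq_zero (fun a b => ?_) fun l => ?_))
    · simp_rw [netForm_swap ω e _ a b, mul_neg, Finset.sum_neg_distrib]
    · have hs' : ∀ i, ∑ k, s k * X k i = 0 := fun i => by simpa using congrFun hs i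
      obtain rfl | rfl | rfl | rfl | rfl | rfl :
        l = 0 ∨ l = 1 ∨ l = 2 ∨ l = 3 ∨ l = 4 ∨ l = 5 := by omega
      · exact hs' 0
      · exact hs' 1
      · exact hs' 3
      · exact hs' 4
      · exact hs' 2
      · change ∑ k, s k * netForm ω e k 2 3 = 0
        simp_rw [h23, mul_neg, Finset.sum_neg_distrib]
        rw [neg_eq_zero]
        exact hs' 0
  obtain ⟨s, hs⟩ := exists_anisotropic_combination hX
  have hs0 : s ≠ 0 := by
    rintro rfl
    simp at hs
  -- The combination with nonzero Pfaffian becomes, up to a scalar, the last form of the net, as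
  -- `finrank_ker_le_seven` requires.
  obtain ⟨e', he', c, hc, hce⟩ := exists_basis_change ω e s hs0
  have hnet : ∀ a b : Fin 7, a < 4 → b < 4 →
      netForm ω e' 2 a b = c * ∑ k, s k * netForm ω e k a b := by
    intro a b ha hb
    rw [Fin.sum_univ_three]
    change quad ω (e' a) (e' b) (e' 4) (e' 5) = _
    rw [hce, he' a ha, he' b hb]
    rfl
  obtain ⟨hW', hind'⟩ := hind e' he'
  have := finrank_ker_le_seven e' hW' hind' (by
    rw [hnet 0 1 (by decide) (by decide), hnet 2 3 (by decide) (by decide),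
      hnet 0 2 (by decide) (by decide), hnet 1 3 (by decide) (by decide),
      hnet 0 3 (by decide) (by decide), hnet 1 2 (by decide) (by decide)]
    simp_rw [h23, mul_neg, Finset.sum_neg_distrib]
    have hne := mul_ne_zero (pow_ne_zero 2 hc) hs
    refine fun h0 => hne ?_
    simp only [X, Matrix.cons_val]
    linear_combination h0)
  omega

/-! ### Sufficiency for the second secant variety, and the theorem. -/

/-- The kernel has dimension at least 21 − 12 = 9, enough for an indecomposable element; this
excludes the rank two normal form, and the other two lead to the secant variety. -/
theorem mem_secant_two_of_contractionRank {ω : ⋀[ℂ]^3 (Fin 7 → ℂ)}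
    (h : contractionRank ω ≤ 12) : ω ∈ affineCone (secantVariety 2 (Gr 2 6)) := by
  have hK : 9 ≤ Module.finrank ℂ (LinearMap.ker (contraction ω)) := by
    have h1 := LinearMap.finrank_range_add_finrank_ker (contraction ω)
    rw [exteriorPower.finrank_eq] at h1
    simp [Nat.choose] at h1
    unfold contractionRank at h
    omega
  obtain ⟨η, hη, hne⟩ := exists_indecomposable_bivector _ hK
  have hη0 : η ≠ 0 := by
    rintro rfl
    refine hne 0 0 (((exteriorPower.ιMulti ℂ 2).map_coord_zero 0 ?_).symm)
    rfl
  rcases exists_basis_of_mem_ker hη0 (LinearMap.mem_ker.1 hη) with ⟨e, he, -⟩ | ⟨e, h⟩ | ⟨e, h⟩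
  · exact absurd he (hne _ _)
  · exact mem_secant_two_of_rank_four (by omega) e h
  · exact mem_secant_two_of_hyperplane e (mem_span_of_quad_rank_six e h)

theorem mem_secant_two_iff {ω : ⋀[ℂ]^3 (Fin 7 → ℂ)} :
    ω ∈ affineCone (secantVariety 2 (Gr 2 6)) ↔ contractionRank ω ≤ 12 :=
  ⟨contractionRank_le_of_mem_affineCone, mem_secant_two_of_contractionRank⟩

end SecantGrassmannian

end

theorem mainTheorem5 :
    (∀ ω : ⋀[ℂ]^3 (Fin 7 → ℂ),
      (ω ∈ SecantGrassmannian.affineCone (SecantGrassmannian.Gr 2 6) ↔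
          SecantGrassmannian.contractionRank ω ≤ 6) ∧
      (ω ∈ SecantGrassmannian.affineCone
            (SecantGrassmannian.secantVariety 2 (SecantGrassmannian.Gr 2 6)) ↔
          SecantGrassmannian.contractionRank ω ≤ 12) ∧
      (ω ∈ SecantGrassmannian.affineCone
            (SecantGrassmannian.secantVariety 3 (SecantGrassmannian.Gr 2 6)) ↔
          SecantGrassmannian.contractionRank ω ≤ 18)) ∧
    -- the 13 × 13 minors of the matrix of `φ_ω` are set-theoretic equations of `σ₂(Gr(2, 6))`
    (∀ (b : Module.Basis (Fin 21) ℂ (⋀[ℂ]^2 (Fin 7 → ℂ)))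
      (c : Module.Basis (Fin 21) ℂ (⋀[ℂ]^5 (Fin 7 → ℂ))) (ω : ⋀[ℂ]^3 (Fin 7 → ℂ)),
      ω ∈ SecantGrassmannian.affineCone
            (SecantGrassmannian.secantVariety 2 (SecantGrassmannian.Gr 2 6)) ↔
        ∀ r s : Fin 13 ↪o Fin 21,
          ((LinearMap.toMatrix b c (SecantGrassmannian.contraction ω)).submatrix r s).det = 0) := by
  refine ⟨fun ω => ⟨⟨fun h => ?_, fun h => ?_⟩, SecantGrassmannian.mem_secant_two_iff,
    SecantGrassmannian.contractionRank_le_of_mem_affineCone,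
    SecantGrassmannian.mem_secant_three_of_contractionRank⟩, fun b c ω => ?_⟩
  · obtain ⟨v, rfl⟩ := SecantGrassmannian.mem_affineCone_Gr_iff.1 h
    exact SecantGrassmannian.contractionRank_ιMulti_le v
  · exact SecantGrassmannian.mem_affineCone_Gr_iff.2
      (SecantGrassmannian.exists_eq_ιMulti_of_contractionRank h)
  · rw [SecantGrassmannian.mem_secant_two_iff]
    exact SecantGrassmannian.finrank_range_le_iff_minors b c _
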